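/- \textbf{Setting.} Let $n=2^m$, identify the points $0,\dots,n-1$ with $m$-bit strings by binary expansion, let $s\cdot t$ be the inner product modulo 2 of $m$-bit strings, $\oplus$ the bitwise sum modulo 2, and let $\log$ be the logarithm to base 2. For $0\le k<n/2$ let $M_k$ be the perfect matching consisting of the pairs $(i,j)$ with $0\le i<n/2$ and $j=\frac n2+\bigl((i+k)\bmod \frac n2\bigr)$. In the \emph{non-local hidden matching game} Alice gets $x\in\{0,1\}^n$ and outputs $a\in\{0,1\}^m$; Bob gets one of the matchings $M=M_k$ and outputs a pair $(i,j)\in M$ and $b\in\{0,1\}^m$; they win iff $(a\oplus b)\cdot(i\oplus j)=x_i\oplus x_j$. In the quantum strategy the players share the maximally entangled state $n^{-1/2}\sum_s|s\rangle|s\rangle$; Alice measures with the vectors $P_x^a=U_xH^{\otimes m}|a\rangle$, where $H^{\otimes m}$ has the entries $(-1)^{s\cdot t}/\sqrt n$ and $U_x$ is diagonal with entries $(-1)^{x_s}$; Bob measures with the vectors $Q_M^{b,(i,j)}=P_{ij}H^{\otimes m}|b\rangle$ for $(i,j)\in M$, where $P_{ij}$ is the coordinate projection on positions $i,j$ (that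 is, with the effects $|v\rangle\langle v|$ for these vectors $v$); each outputs the label of the outcome. Let $P_x$ and $Q_M$ be the sets of rank-one orthogonal projectors onto the lines spanned by Alice's, respectively Bob's, vectors, and let $S=\bigcup_xP_x\cup\bigcup_kQ_{M_k}$. A finite set $S$ of rank-one projectors on $\mathbb C^n$ is a \emph{Kochen--Specker set} if there is no $f:S\to\{0,1\}$ with $\sum_{P\in O}f(P)\le1$ for every set $O\subseteq S$ of mutually orthogonal projectors and $\sum_{P\in B}f(P)=1$ for every set $B\subseteq S$ of $n$ mutually orthogonal projectors. Its orthogonality graph $G$ has vertex set $S$, and distinct elements are adjacent iff they are orthogonal; $\alpha(G)$ is the independence number and $\theta(G)$ the Lov\'asz number of $G$ (with the convention $\alpha\le\theta$). Put $\beta_q=\frac{\theta(G)}{\theta(G)}-\frac12$ (quantum bias) and $\beta_c=\frac{\alpha(G)}{\theta(G)}-\frac12$ (classical bias). \textbf{Theorem.} Let $n\ge2^{17}$ be a power of 2. No classical (deterministic) strategy wins the game on all inputs, while the above is a valid quantum strategy that wins with probability 1 on all inputs. Each $P_x$ and each $Q_{M_k}$ consists of $n$ mutually orthogonal rank-one projectors,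 and $S$ is a Kochen--Specker set in $\mathbb C^n$ with exactly $N=2^{n-1}+n^2/2$ projectors. Its orthogonality graph $G$ satisfies $$\theta(G)=\frac{2^{n-1}}n+\frac n2,\qquad \alpha(G)\le\Bigl(\frac12+\frac{8\sqrt n\log n}{n-1}\Bigr)\theta(G).$$ Consequently $\beta_q=\frac12$, $\beta_c\le\frac{8\sqrt n\log n}{n-1}$, and $$\beta_q\ \ge\ \frac{n-1}{16\sqrt n\log n}\;\beta_c .$$ Moreover, $\beta_c\neq0$ and $|\beta_q/\beta_c|\le C\,\sqrt n/\log n$ with an absolute constant $C$, for all such $n$. -/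

import Mathlib

noncomputable section

/-- The Hilbert space `ℂ^n`. -/
abbrev QSpace (n : ℕ) : Type := EuclideanSpace ℂ (Fin n)

/-- Operators on `ℂ^n`. -/
abbrev QOp (n : ℕ) : Type := QSpace n →L[ℂ] QSpace n

/-! ### Kochen-Specker sets, orthogonality graphs, Lovász number -/

/-- `P` is a rank-one orthogonal projector. -/
def IsRankOneProjector {n : ℕ} (P : QOp n) : Prop :=
  IsStarProjection P ∧ Module.finrank ℂ (LinearMap.range P.toLinearMap) = 1

/-- A set of mutually orthogonal projectors. -/
def MutuallyOrthogonal {n : ℕ} (B : Set (QOp n)) : Prop :=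
  B.Pairwise fun P Q => P * Q = 0

/-- `B` is a complete (projective, rank-one) measurement basis of `ℂ^n`:
`n` mutually orthogonal rank-one projectors. -/
def IsMeasurementBasis {n : ℕ} (B : Set (QOp n)) : Prop :=
  (∀ P ∈ B, IsRankOneProjector P) ∧ MutuallyOrthogonal B ∧ B.Finite ∧ B.ncard = n

/-- `f` is a `{0,1}`-coloring of `S`: values in `{0,1}`, at most one value `1` among mutually
orthogonal elements, exactly one value `1` in every complete basis contained in `S`. -/
def IsZeroOneColoring {n : ℕ} (S : Set (QOp n)) (f : QOp n → ℕ) : Prop :=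
  (∀ P ∈ S, f P = 0 ∨ f P = 1) ∧
  (∀ O : Finset (QOp n), (O : Set (QOp n)) ⊆ S → MutuallyOrthogonal (O : Set (QOp n)) →
    ∑ P ∈ O, f P ≤ 1) ∧
  (∀ B : Finset (QOp n), (B : Set (QOp n)) ⊆ S → IsMeasurementBasis (B : Set (QOp n)) →
    ∑ P ∈ B, f P = 1)

/-- A Kochen-Specker set in `ℂ^n`: a finite set of rank-one projectors without
`{0,1}`-coloring. -/
def IsKochenSpeckerSet {n : ℕ} (S : Set (QOp n)) : Prop :=
  S.Finite ∧ (∀ P ∈ S, IsRankOneProjector P) ∧ ¬ ∃ f : QOp n → ℕ, IsZeroOneColoring S f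

/-- The orthogonality graph: the vertices are the elements of `S`, and two distinct vertices are
adjacent iff they are orthogonal. -/
def orthogonalityGraph {n : ℕ} (S : Set (QOp n)) : SimpleGraph S :=
  SimpleGraph.fromRel fun P Q : S => (P : QOp n) * (Q : QOp n) = 0

/-- The Lovász number `min_{u, c} max_i 1 / ⟪c, u i⟫²`, over unit vectors `c` and systems of unit
vectors `u` in a Euclidean space such that distinct non-adjacent vertices get orthogonal vectors.
(The inequality `1 ≤ t * ⟪c, u i⟫²` says `1 / ⟪c, u i⟫² ≤ t`, with `1 / 0 = ∞`.) -/
def lovaszTheta {V : Type*} (G : SimpleGraph V) : ℝ :=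
  sInf {t : ℝ | ∃ (d : ℕ) (c : EuclideanSpace ℝ (Fin d)) (u : V → EuclideanSpace ℝ (Fin d)),
    ‖c‖ = 1 ∧ (∀ i, ‖u i‖ = 1) ∧
    (∀ i j, i ≠ j → ¬ G.Adj i j → inner ℝ (u i) (u j) = 0) ∧
    ∀ i, 1 ≤ t * (inner ℝ c (u i)) ^ 2}

/-- The quantum bias: the quantum value `θ(G)`, normalized so that `θ(G)` becomes `1`, minus the
random assignment value `1/2`. -/
def quantumBias {V : Type*} (G : SimpleGraph V) : ℝ :=
  lovaszTheta G / lovaszTheta G - 1 / 2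

/-- The classical bias: the classical value `α(G)` in the same normalization, minus `1/2`. -/
def classicalBias {V : Type*} (G : SimpleGraph V) : ℝ :=
  (G.indepNum : ℝ) / lovaszTheta G - 1 / 2

/-! ### The non-local hidden matching game on `n = 2 ^ m` points

The points are `0, …, n - 1`, identified with `m`-bit strings through binary expansion. -/

/-- The inner product modulo 2 of the `m`-bit strings `s` and `t`. -/
def bitDot (m s t : ℕ) : ZMod 2 :=
  ∑ r ∈ Finset.range m, if s.testBit r && t.testBit r then 1 else 0

/-- The perfect matching `M_k`: the point `i < n/2` is matched with
`n/2 + (i + k mod n/2)`. -/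
def hmMatching (m : ℕ) (k : Fin (2 ^ m / 2)) : Finset (Fin (2 ^ m) × Fin (2 ^ m)) :=
  Finset.univ.filter fun e =>
    (e.1 : ℕ) < 2 ^ m / 2 ∧ (e.2 : ℕ) = 2 ^ m / 2 + ((e.1 : ℕ) + k) % (2 ^ m / 2)

/-- The winning condition. Alice gets `x ∈ {0,1}^n` and answers the `m`-bit string `a`; Bob gets
`M_k` and answers a pair `e = (i, j)` and an `m`-bit string `b`. They win iff `(i, j) ∈ M_k` and
`(a ⊕ b) · (i ⊕ j) = x_i ⊕ x_j`. -/
def HMWins (m : ℕ) (x : Fin (2 ^ m) → ZMod 2) (k : Fin (2 ^ m / 2))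
    (a : Fin (2 ^ m)) (e : Fin (2 ^ m) × Fin (2 ^ m)) (b : Fin (2 ^ m)) : Prop :=
  e ∈ hmMatching m k ∧
    bitDot m ((a : ℕ) ^^^ (b : ℕ)) ((e.1 : ℕ) ^^^ (e.2 : ℕ)) = x e.1 + x e.2

/-- Entry `(s, t)` of the Hadamard matrix `H^{⊗ m}`. -/
def hadamardEntry (m s t : ℕ) : ℂ :=
  (-1) ^ (bitDot m s t).val / (Real.sqrt (2 ^ m) : ℂ)

/-- Alice's vector `U_x H^{⊗ m} |a⟩`, where `U_x` is diagonal with entries `(-1)^{x_s}`. -/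
def aliceVec (m : ℕ) (x : Fin (2 ^ m) → ZMod 2) (a : Fin (2 ^ m)) : QSpace (2 ^ m) :=
  WithLp.toLp 2 fun s => (-1) ^ (x s).val * hadamardEntry m s a

/-- Bob's vector `P_{ij} H^{⊗ m} |b⟩`, where `e = (i, j)` and `P_{ij}` is the coordinate projection
on the positions `i` and `j`. -/
def bobVec (m : ℕ) (e : Fin (2 ^ m) × Fin (2 ^ m)) (b : Fin (2 ^ m)) : QSpace (2 ^ m) :=
  WithLp.toLp 2 fun s => if s = e.1 ∨ s = e.2 then hadamardEntry m s b else 0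

/-- The maximally entangled state `n^{-1/2} ∑ s, |s⟩|s⟩`, that is, `m` EPR pairs. -/
def maxEntangled (m : ℕ) : EuclideanSpace ℂ (Fin (2 ^ m) × Fin (2 ^ m)) :=
  WithLp.toLp 2 fun p => if p.1 = p.2 then 1 / (Real.sqrt (2 ^ m) : ℂ) else 0

/-- The product vector `v ⊗ w`. -/
def prodVec {n : ℕ} (v w : QSpace n) : EuclideanSpace ℂ (Fin n × Fin n) :=
  WithLp.toLp 2 fun p => v p.1 * w p.2

open Classical in
/-- The probability that the quantum strategy wins on the inputs `x` and `M_k`: the players share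
the maximally entangled state, Alice measures with the effects `|aliceVec⟩⟨aliceVec|` and Bob with
the effects `|bobVec⟩⟨bobVec|` for `e ∈ M_k`, and each player answers the label of the outcome. -/
def hmQuantumWinProb (m : ℕ) (x : Fin (2 ^ m) → ZMod 2) (k : Fin (2 ^ m / 2)) : ℝ :=
  ∑ a : Fin (2 ^ m), ∑ e ∈ hmMatching m k, ∑ b : Fin (2 ^ m),
    if HMWins m x k a e b then
      ‖inner ℂ (prodVec (aliceVec m x a) (bobVec m e b)) (maxEntangled m)‖ ^ 2
    else 0

/-- The orthogonal projector on the line spanned by `v`. -/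
def lineProj {n : ℕ} (v : QSpace n) : QOp n := (ℂ ∙ v).starProjection

/-- The basis `P_x` measured by Alice on the input `x`. -/
def aliceBasis (m : ℕ) (x : Fin (2 ^ m) → ZMod 2) : Set (QOp (2 ^ m)) :=
  {P | ∃ a, P = lineProj (aliceVec m x a)}

/-- The basis `Q_M` measured by Bob on the input `M = M_k`. -/
def bobBasis (m : ℕ) (k : Fin (2 ^ m / 2)) : Set (QOp (2 ^ m)) :=
  {P | ∃ e ∈ hmMatching m k, ∃ b, P = lineProj (bobVec m e b)}

/-- The union of all measurement bases of the two players. -/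
def hmSet (m : ℕ) : Set (QOp (2 ^ m)) :=
  (⋃ x, aliceBasis m x) ∪ ⋃ k, bobBasis m k

/-- The orthogonality graph of `hmSet m`. -/
def hmGraph (m : ℕ) : SimpleGraph (hmSet m) := orthogonalityGraph (hmSet m)

end

/-! Everything rests on one fact: the vectors of losing answers are orthogonal
(`inner_aliceVec_bobVec_of_losing`). On the maximally entangled state this removes losing outcomes,
so the quantum strategy is perfect. A {0,1}-coloring would select one answer per question and never
two orthogonal projectors, hence would be a perfect classical strategy.

Such a strategy fails by counting. The matchings are edge-disjoint, so Bob uses n/2 different edges,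
and if both his left and his right endpoints took at most m values, there would be at most m² < n/2
of them. On more than m distinct endpoints of one side the input x can realize every parity pattern,
while Alice has only 2^m answers.

For θ, S is a disjoint union of N/n bases, each a clique, which gives an orthonormal representation
of value N/n. Conversely, tensoring any representation with the vectors of the projectors gives an
orthonormal system, and Bessel's inequality yields N ≤ t n (`lovaszTheta_of_partition`).

For α, Alice's lines are sign vectors up to sign, orthogonal exactly at Hamming distance n/2. An
independent set is thus a code avoiding this distance, and the Frankl–Wilson polynomial method
modulo 2 (`card_le_of_forbidden_distances`) makes it exponentially smaller than 2^n; Bob's n²/2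
lines are counted trivially. This gives α ≤ θ/4, so the classical bias is at most -1/4: the upper
bounds on it hold by sign, and the ratio of the biases is at most 2 in absolute value. -/

/-! ### Binary codes with forbidden distances -/

section ForbiddenDistances

variable {ι : Type*}

/-- If `2 ^ r` does not divide `t`, then `(t + 2 ^ r - 1).choose (2 ^ r - 1)` is even. -/
theorem even_choose_of_not_dvd {r k t : ℕ} (hk : k + 1 = 2 ^ r) (ht : ¬ 2 ^ r ∣ t) :
    2 ∣ (t + k).choose k := by
  by_contra hodd
  -- Absorption: 2 ^ r divides (t + 2 ^ r) times the binomial coefficient, so an odd coefficient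
  -- would force 2 ^ r to divide t.
  have h := Nat.add_one_mul_choose_eq (t + k) k
  rw [hk] at h
  have hc : Nat.Coprime (2 ^ r) ((t + k).choose k) :=
    Nat.Coprime.pow_left r ((Nat.Prime.coprime_iff_not_dvd Nat.prime_two).2 hodd)
  have h1 : 2 ^ r ∣ t + k + 1 := hc.dvd_of_dvd_mul_right (h ▸ Dvd.intro_left _ rfl)
  rw [add_assoc, hk] at h1
  exact ht ((Nat.dvd_add_left dvd_rfl).1 h1)

/-- The monomial function `y ↦ ∏ i ∈ T, y i` on the cube. -/
def cubeMonomial (T : Finset ι) : (ι → ZMod 2) → ℚ := fun y => ∏ i ∈ T, ((y i).val : ℚ)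

/-- The functions on the cube of degree at most `k`. -/
def cubePoly (ι : Type*) (k : ℕ) : Submodule ℚ ((ι → ZMod 2) → ℚ) :=
  Submodule.span ℚ (cubeMonomial '' {T : Finset ι | T.card ≤ k})

theorem cubeMonomial_mem {T : Finset ι} {k : ℕ} (h : T.card ≤ k) :
    cubeMonomial T ∈ cubePoly ι k :=
  Submodule.subset_span ⟨T, h, rfl⟩

theorem cubePoly_mono {k l : ℕ} (h : k ≤ l) : cubePoly ι k ≤ cubePoly ι l :=
  Submodule.span_mono (Set.image_mono fun _ hT => le_trans hT h)

/-- Coordinates on the cube are idempotent, so a repeated factor is absorbed and monomials stay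
squarefree. -/
theorem cubePoly_mul_coord {k : ℕ} {f : (ι → ZMod 2) → ℚ} (hf : f ∈ cubePoly ι k) (i : ι) :
    (fun y => f y * ((y i).val : ℚ)) ∈ cubePoly ι (k + 1) := by
  classical
  induction hf using Submodule.span_induction with
  | mem f hf =>
    obtain ⟨T, hT, rfl⟩ := hf
    replace hT : T.card ≤ k := hT
    have : (fun y : ι → ZMod 2 => cubeMonomial T y * ((y i).val : ℚ))
        = cubeMonomial (insert i T) := by
      funext y
      by_cases hi : i ∈ T
      · rw [Finset.insert_eq_of_mem hi]
        have hsq : ∀ z : ZMod 2, ((z.val : ℚ)) * z.val = z.val := by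
          intro z
          have : ∀ z : ZMod 2, z.val * z.val = z.val := by decide
          exact_mod_cast this z
        simp only [cubeMonomial]
        rw [← Finset.mul_prod_erase T _ hi, mul_right_comm, hsq]
      · simp only [cubeMonomial]
        rw [Finset.prod_insert hi, mul_comm]
    rw [this]
    exact cubeMonomial_mem ((Finset.card_insert_le _ _).trans (by omega))
  | zero =>
    convert (cubePoly ι (k + 1)).zero_mem using 1
    funext y
    simp
  | add f g _ _ hf hg =>
    have := Submodule.add_mem _ hf hg
    convert this using 1
    funext y
    simp [add_mul]
  | smul c f _ hf =>
    have := Submodule.smul_mem _ c hf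
    convert this using 1
    funext y
    simp [mul_assoc]

variable [Fintype ι]

/-- For bits, the indicator of a ≠ b is a + (1 - 2a) b. With x fixed the distance is affine in y, so
each factor of `distBinomial` costs one degree. -/
theorem hammingDist_eq_sum_affine (x y : ι → ZMod 2) :
    (hammingDist x y : ℚ) =
      ∑ i, (((x i).val : ℚ) + (1 - 2 * ((x i).val : ℚ)) * ((y i).val : ℚ)) := by
  rw [hammingDist, Finset.card_filter]
  push_cast
  refine Finset.sum_congr rfl fun i _ => ?_
  generalize x i = a
  generalize y i = b
  have h : ∀ z : ZMod 2, z = 0 ∨ z = 1 := by decide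
  rcases h a with rfl | rfl <;> rcases h b with rfl | rfl <;> norm_num [ZMod.val_one]

theorem cubePoly_mul_hammingDist {k : ℕ} {f : (ι → ZMod 2) → ℚ} (hf : f ∈ cubePoly ι k)
    (x : ι → ZMod 2) (c : ℚ) :
    (fun y => f y * ((hammingDist x y : ℚ) / 2 + c)) ∈ cubePoly ι (k + 1) := by
  have h : (fun y => f y * ((hammingDist x y : ℚ) / 2 + c)) =
      c • f + ∑ i, ((((x i).val : ℚ) / 2) • f +
        ((1 - 2 * ((x i).val : ℚ)) / 2) • fun y => f y * ((y i).val : ℚ)) := by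
    funext y
    simp only [hammingDist_eq_sum_affine, Pi.add_apply, Finset.sum_apply, Pi.smul_apply,
      smul_eq_mul]
    rw [mul_add, Finset.sum_div, Finset.mul_sum, add_comm, mul_comm (f y) c]
    congr 1
    exact Finset.sum_congr rfl fun i _ => by ring
  rw [h]
  have hf' := cubePoly_mono (Nat.le_succ k) hf
  exact Submodule.add_mem _ (Submodule.smul_mem _ _ hf') (Submodule.sum_mem _ fun i _ =>
    Submodule.add_mem _ (Submodule.smul_mem _ _ hf')
      (Submodule.smul_mem _ _ (cubePoly_mul_coord hf i)))

/-- The polynomial `C(d / 2 + k, k)` of the Hamming distance `d` to `x`. -/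
def distBinomial (k : ℕ) (x y : ι → ZMod 2) : ℚ :=
  (k.factorial : ℚ)⁻¹ * ∏ j ∈ Finset.range k, ((hammingDist x y : ℚ) / 2 + (1 + j))

theorem distBinomial_mem (k : ℕ) (x : ι → ZMod 2) : distBinomial k x ∈ cubePoly ι k := by
  have h : ∀ l : ℕ, (fun y => ∏ j ∈ Finset.range l, ((hammingDist x y : ℚ) / 2 + (1 + j)))
      ∈ cubePoly ι l := by
    intro l
    induction l with
    | zero =>
      have h1 : (fun y : ι → ZMod 2 =>
          ∏ j ∈ Finset.range 0, ((hammingDist x y : ℚ) / 2 + (1 + j))) = cubeMonomial ∅ := by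
        funext y
        simp [cubeMonomial]
      rw [h1]
      exact cubeMonomial_mem (by simp)
    | succ l ih =>
      simp_rw [Finset.prod_range_succ]
      exact cubePoly_mul_hammingDist ih x _
  exact Submodule.smul_mem _ (k.factorial : ℚ)⁻¹ (h k)

/-- At even distances the rational polynomial takes integer values, which can then be reduced modulo
2. -/
theorem distBinomial_eq_choose {k t : ℕ} {x y : ι → ZMod 2} (h : hammingDist x y = 2 * t) :
    distBinomial k x y = ((t + k).choose k : ℕ) := by
  have h1 := Nat.ascFactorial_eq_factorial_mul_choose t k
  rw [Nat.ascFactorial_eq_prod_range] at h1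
  have h2 : ((∏ i ∈ Finset.range k, (t + 1 + i) : ℕ) : ℚ) = k.factorial * (t + k).choose k := by
    exact_mod_cast h1
  have hk : (k.factorial : ℚ) ≠ 0 := by exact_mod_cast k.factorial_ne_zero
  rw [distBinomial, h]
  push_cast at h2 ⊢
  rw [inv_mul_eq_iff_eq_mul₀ hk, ← h2]
  exact Finset.prod_congr rfl fun i _ => by ring

/-- A matrix of integers that is the identity modulo 2 is nonsingular. -/
theorem det_ne_zero_of_odd_diag {κ : Type*} [Fintype κ] [DecidableEq κ] (A : Matrix κ κ ℤ)
    (hd : ∀ i, A i i = 1) (ho : ∀ i j, i ≠ j → (2 : ℤ) ∣ A i j) : A.det ≠ 0 := by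
  intro h
  have h1 := RingHom.map_det (Int.castRingHom (ZMod 2)) A
  have h2 : (Int.castRingHom (ZMod 2)).mapMatrix A = 1 := by
    ext i j
    by_cases hij : i = j
    · subst hij
      simp [hd]
    · rw [Matrix.one_apply_ne hij]
      simpa using (ZMod.intCast_zmod_eq_zero_iff_dvd _ 2).2 (ho i j hij)
  rw [h, h2] at h1
  simp at h1

/-- A binary code all of whose distances are even and not divisible by `2 ^ (r + 1)` has at most
as many elements as there are sets of fewer than `2 ^ r` coordinates. -/
theorem card_le_of_forbidden_distances {r k : ℕ} (hk : k + 1 = 2 ^ r)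
    (F : Finset (ι → ZMod 2)) (heven : ∀ x ∈ F, ∀ y ∈ F, 2 ∣ hammingDist x y)
    (hne : ∀ x ∈ F, ∀ y ∈ F, x ≠ y → ¬ 2 ^ (r + 1) ∣ hammingDist x y) :
    F.card ≤ (Finset.univ.filter fun T : Finset ι => T.card ≤ k).card := by
  classical
  -- The Frankl–Wilson matrix: its diagonal entries are C(k, k) = 1, and the forbidden distances
  -- make all others even.
  let A : Matrix F F ℤ := fun x y => (((hammingDist x.1 y.1 / 2 + k).choose k : ℕ) : ℤ)
  have hA : A.det ≠ 0 := by
    apply det_ne_zero_of_odd_diag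
    · intro x
      simp [A]
    · intro x y hxy
      have hxy' : x.1 ≠ y.1 := fun h => hxy (Subtype.ext h)
      have := even_choose_of_not_dvd (t := hammingDist x.1 y.1 / 2) hk (by
        intro hd
        apply hne x.1 x.2 y.1 y.2 hxy'
        have h2 := Nat.mul_dvd_mul_left 2 hd
        rwa [Nat.mul_div_cancel' (heven x.1 x.2 y.1 y.2), ← pow_succ'] at h2)
      exact Int.natCast_dvd_natCast.2 this
  let B : Matrix F F ℚ := (Int.castRingHom ℚ).mapMatrix A
  have hB : IsUnit B := by
    rw [Matrix.isUnit_iff_isUnit_det, isUnit_iff_ne_zero]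
    change ((Int.castRingHom ℚ).mapMatrix A).det ≠ 0
    rw [← RingHom.map_det]
    simpa using hA
  have hrow : LinearIndependent ℚ B.row := Matrix.linearIndependent_rows_iff_isUnit.2 hB
  -- Restricted to F, the polynomials are the rows of B, so they are independent already on F.
  have hlin : LinearIndependent ℚ fun x : F => distBinomial k x.1 := by
    apply LinearIndependent.of_comp
      (LinearMap.funLeft ℚ ℚ (Subtype.val : F → (ι → ZMod 2)))
    convert hrow using 1
    funext x y
    have h2 : hammingDist x.1 y.1 = 2 * (hammingDist x.1 y.1 / 2) :=
      (Nat.mul_div_cancel' (heven x.1 x.2 y.1 y.2)).symm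
    simp only [Function.comp, LinearMap.funLeft_apply]
    rw [distBinomial_eq_choose h2]
    change _ = ((A x y : ℤ) : ℚ)
    simp [A]
  calc F.card = Module.finrank ℚ (Submodule.span ℚ (Set.range fun x : F => distBinomial k x.1)) := by
        rw [finrank_span_eq_card hlin, Fintype.card_coe]
    _ ≤ Module.finrank ℚ (cubePoly ι k) := by
        apply Submodule.finrank_mono
        rw [Submodule.span_le]
        rintro _ ⟨x, rfl⟩
        exact distBinomial_mem k x.1
    _ ≤ ((Finset.univ.filter fun T : Finset ι => T.card ≤ k).image cubeMonomial).card := by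
        have h := finrank_span_finset_le_card (R := ℚ)
          ((Finset.univ.filter fun T : Finset ι => T.card ≤ k).image cubeMonomial)
        have hset : (((Finset.univ.filter fun T : Finset ι => T.card ≤ k).image cubeMonomial :
            Finset _) : Set _) = cubeMonomial '' {T : Finset ι | T.card ≤ k} := by
          rw [Finset.coe_image, Finset.coe_filter]
          simp
        rwa [hset] at h
    _ ≤ _ := Finset.card_image_le

/-- Chernoff-type bound for the number of sets of size at most `k`. -/
theorem card_filter_card_le_bound (k : ℕ) :
    ((Finset.univ.filter fun T : Finset ι => T.card ≤ k).card : ℝ) ≤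
      2 ^ k * (3 / 2) ^ Fintype.card ι := by
  -- Weighting T by 2^(-|T|) gives total mass (3/2)^|ι|, and every counted set has weight at least
  -- 2^(-k).
  have h := Fintype.sum_pow_mul_eq_add_pow ι (1 / 2 : ℝ) 1
  simp only [one_pow, mul_one] at h
  have h1 : ∑ T ∈ Finset.univ.filter (fun T : Finset ι => T.card ≤ k), (1 / 2 : ℝ) ^ k ≤
      ∑ T : Finset ι, (1 / 2 : ℝ) ^ T.card := by
    refine (Finset.sum_le_sum fun T hT => ?_).trans
      (Finset.sum_le_sum_of_subset_of_nonneg (Finset.filter_subset _ _) fun _ _ _ => by positivity)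
    exact pow_le_pow_of_le_one (by norm_num) (by norm_num) (Finset.mem_filter.1 hT).2
  rw [h, Finset.sum_const, nsmul_eq_mul] at h1
  have h2 : (2 : ℝ) ^ k * (1 / 2 : ℝ) ^ k = 1 := by
    rw [← mul_pow]
    norm_num
  calc _ = 2 ^ k * (((Finset.univ.filter fun T : Finset ι => T.card ≤ k).card : ℝ)
          * (1 / 2) ^ k) := by rw [mul_left_comm, h2, mul_one]
    _ ≤ 2 ^ k * (1 / 2 + 1) ^ Fintype.card ι := by gcongr
    _ = _ := by norm_num

end ForbiddenDistances

/-! ### Lovász number of a disjoint union of measurement bases -/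

section Lovasz

variable {n : ℕ}

/-- A unit vector spanning the range of a rank-one projector. -/
theorem IsRankOneProjector.exists_unit {P : QOp n} (hP : IsRankOneProjector P) :
    ∃ w : QSpace n, ‖w‖ = 1 ∧ P w = w := by
  obtain ⟨hs, hr⟩ := hP
  obtain ⟨v, hv, -⟩ := finrank_eq_one_iff'.1 hr
  obtain ⟨⟨_, u, rfl⟩, hv⟩ : ∃ v : LinearMap.range P.toLinearMap, v ≠ 0 := ⟨v, hv⟩
  have hv' : P u ≠ 0 := fun h => hv (Subtype.ext h)
  have hPP : P (P u) = P u := congrArg (fun T : QOp n => T u) hs.isIdempotentElem.eq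
  refine ⟨((‖P u‖ : ℂ)⁻¹) • P u, ?_, ?_⟩
  · rw [norm_smul, norm_inv, Complex.norm_real, norm_norm, inv_mul_cancel₀ (norm_ne_zero_iff.2 hv')]
  · rw [map_smul, hPP]

theorem inner_eq_zero_of_mul_eq_zero {P Q : QOp n} (hP : IsStarProjection P) {v w : QSpace n}
    (hv : P v = v) (hw : Q w = w) (h : P * Q = 0) : inner ℂ v w = 0 := by
  have h1 : inner ℂ (P v) w = inner ℂ v (P w) := by
    have := ContinuousLinearMap.adjoint_inner_left P w v
    rwa [← ContinuousLinearMap.star_eq_adjoint, hP.isSelfAdjoint.star_eq] at this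
  rw [← hv, h1, ← hw]
  have : P (Q w) = 0 := congrArg (fun T : QOp n => T w) h
  rw [this, inner_zero_right]

theorem IsStarProjection.mul_eq_zero_symm {P Q : QOp n} (hP : IsStarProjection P)
    (hQ : IsStarProjection Q) (h : P * Q = 0) : Q * P = 0 := by
  have := congrArg star h
  rw [star_mul, hP.isSelfAdjoint.star_eq, hQ.isSelfAdjoint.star_eq,
    ContinuousLinearMap.star_eq_adjoint, map_zero] at this
  exact this

/-- The tensor product of a real vector and a complex vector. -/
def mixedProd {d : ℕ} (u : EuclideanSpace ℝ (Fin d)) (w : QSpace n) :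
    EuclideanSpace ℂ (Fin d × Fin n) :=
  WithLp.toLp 2 fun p => (u p.1 : ℂ) * w p.2

theorem inner_mixedProd {d : ℕ} (u u' : EuclideanSpace ℝ (Fin d)) (w w' : QSpace n) :
    inner ℂ (mixedProd u w) (mixedProd u' w') = (inner ℝ u u' : ℂ) * inner ℂ w w' := by
  simp only [mixedProd, PiLp.inner_apply, RCLike.inner_apply, Fintype.sum_prod_type,
    Complex.ofReal_sum, Finset.sum_mul_sum]
  refine Finset.sum_congr rfl fun i _ => Finset.sum_congr rfl fun j _ => ?_
  simp
  ring

/-- In every orthonormal representation, the squared overlaps with the handle sum up to at most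
the dimension of the projectors. -/
theorem sum_inner_sq_le {S : Set (QOp n)} [Fintype S] (hS : ∀ P ∈ S, IsRankOneProjector P) {d : ℕ}
    (c : EuclideanSpace ℝ (Fin d)) (u : S → EuclideanSpace ℝ (Fin d)) (hc : ‖c‖ = 1)
    (hu : ∀ i, ‖u i‖ = 1)
    (huv : ∀ i j, i ≠ j → ¬ (orthogonalityGraph S).Adj i j → inner ℝ (u i) (u j) = 0) :
    ∑ i, (inner ℝ c (u i)) ^ 2 ≤ n := by
  choose w hw hPw using fun P : S => (hS P P.2).exists_unit
  -- For distinct vertices one tensor factor is orthogonal: `w` on edges, `u` on non-edges.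
  have hon : Orthonormal ℂ fun i : S => mixedProd (u i) (w i) := by
    constructor
    · intro i
      have h := inner_mixedProd (u i) (u i) (w i) (w i)
      rw [real_inner_self_eq_norm_sq, inner_self_eq_norm_sq_to_K, inner_self_eq_norm_sq_to_K,
        hu, hw] at h
      have h2 : ‖mixedProd (u i) (w i)‖ ^ 2 = 1 := by
        apply Complex.ofReal_injective
        simpa using h
      exact (pow_eq_one_iff_of_nonneg (norm_nonneg _) two_ne_zero).1 h2
    · intro i j hij
      rw [inner_mixedProd]
      by_cases hadj : (orthogonalityGraph S).Adj i j
      · have hz : inner ℂ (w i) (w j) = 0 := by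
          rcases ((SimpleGraph.fromRel_adj _ _ _).1 hadj).2 with h | h
          · exact inner_eq_zero_of_mul_eq_zero (hS i i.2).1 (hPw i) (hPw j) h
          · exact inner_eq_zero_of_mul_eq_zero (hS i i.2).1 (hPw i) (hPw j)
              ((hS j j.2).1.mul_eq_zero_symm (hS i i.2).1 h)
        rw [hz, mul_zero]
      · rw [huv i j hij hadj, Complex.ofReal_zero, zero_mul]
  -- Bessel's inequality for the unit vector c ⊗ e_s. Summed over s, the factors ‖w i s‖² disappear
  -- because `w i` is a unit vector.
  have hb : ∀ s : Fin n, ∑ i, (inner ℝ c (u i)) ^ 2 * ‖w i s‖ ^ 2 ≤ 1 := by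
    intro s
    have h := hon.sum_inner_products_le (mixedProd c (EuclideanSpace.single s (1 : ℂ)))
      (s := Finset.univ)
    have h1 : ‖mixedProd c (EuclideanSpace.single s (1 : ℂ))‖ ^ 2 = 1 := by
      have h := inner_mixedProd c c (EuclideanSpace.single s (1 : ℂ)) (EuclideanSpace.single s 1)
      rw [real_inner_self_eq_norm_sq, inner_self_eq_norm_sq_to_K, inner_self_eq_norm_sq_to_K,
        hc] at h
      apply Complex.ofReal_injective
      simpa using h
    rw [h1] at h
    refine le_trans (le_of_eq (Finset.sum_congr rfl fun i _ => ?_)) h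
    rw [inner_mixedProd, norm_mul, mul_pow, real_inner_comm, Complex.norm_real, Real.norm_eq_abs,
      sq_abs, EuclideanSpace.inner_single_right]
    simp
  calc ∑ i, (inner ℝ c (u i)) ^ 2 = ∑ i, ∑ s, (inner ℝ c (u i)) ^ 2 * ‖w i s‖ ^ 2 := by
        refine Finset.sum_congr rfl fun i _ => ?_
        rw [← Finset.mul_sum, ← EuclideanSpace.norm_sq_eq, hw]
        simp
    _ = ∑ s, ∑ i, (inner ℝ c (u i)) ^ 2 * ‖w i s‖ ^ 2 := Finset.sum_comm
    _ ≤ ∑ _s : Fin n, (1 : ℝ) := Finset.sum_le_sum fun s _ => hb s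
    _ = n := by simp

/-- The Lovász number of a nonempty disjoint union of measurement bases of `ℂ^n`. -/
theorem lovaszTheta_of_partition {S : Set (QOp n)} (𝔅 : Finset (Set (QOp n)))
    (hn : 0 < n) (hne : S.Nonempty)
    (hB : ∀ B ∈ 𝔅, IsMeasurementBasis B) (hU : S = ⋃ B ∈ 𝔅, B)
    (hdisj : ∀ B ∈ 𝔅, ∀ B' ∈ 𝔅, ∀ P, P ∈ B → P ∈ B' → B = B') :
    lovaszTheta (orthogonalityGraph S) = (S.ncard : ℝ) / n := by
  classical
  have hfin : S.Finite := by
    rw [hU]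
    exact 𝔅.finite_toSet.biUnion fun B h => (hB B h).2.2.1
  have : Fintype S := hfin.fintype
  have hS : ∀ P ∈ S, IsRankOneProjector P := by
    intro P hP
    rw [hU] at hP
    obtain ⟨B, hB', hPB⟩ := Set.mem_iUnion₂.1 hP
    exact (hB B hB').1 P hPB
  have hcard : S.ncard = 𝔅.card * n := by
    have h := 𝔅.finite_toSet.ncard_biUnion (s := fun B => B) (fun B h => (hB B h).2.2.1) (by
      intro B h B' h' hne'
      rw [Function.onFun, Set.disjoint_left]
      exact fun P hP hP' => hne' (hdisj B h B' h' P hP hP'))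
    rw [finsum_mem_coe_finset, Finset.sum_congr rfl fun B h => (hB B h).2.2.2,
      Finset.sum_const, smul_eq_mul] at h
    rw [hU]
    exact h
  have hn' : (0 : ℝ) < n := by exact_mod_cast hn
  have hθ : (S.ncard : ℝ) / n = 𝔅.card := by
    rw [hcard]
    push_cast
    field_simp
  have hcS : (Fintype.card S : ℝ) = S.ncard := by
    rw [← Nat.card_coe_set_eq, Nat.card_eq_fintype_card]
  have hpos : 0 < 𝔅.card := by
    have := (Set.ncard_pos hfin).2 hne
    rw [hcard] at this
    exact Nat.pos_of_mul_pos_right this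
  refine IsLeast.csInf_eq ⟨?_, ?_⟩
  · rw [hθ]
    have hcl : ∀ P : S, ∃ B : 𝔅, (P : QOp n) ∈ B.1 := by
      rintro ⟨P, hP⟩
      rw [hU] at hP
      obtain ⟨B, hB', hPB⟩ := Set.mem_iUnion₂.1 hP
      exact ⟨⟨B, hB'⟩, hPB⟩
    choose cl hcl using hcl
    let e := 𝔅.equivFin
    have hK : (0 : ℝ) < 𝔅.card := by exact_mod_cast hpos
    -- All vertices of one basis form a clique and may share a coordinate vector. The handle is the
    -- uniform unit vector, whose squared overlap with each of them is 1 / |𝔅|.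
    refine ⟨𝔅.card, WithLp.toLp 2 fun _ => (Real.sqrt 𝔅.card)⁻¹,
      fun P => EuclideanSpace.single (e (cl P)) 1, ?_, ?_, ?_, ?_⟩
    · rw [EuclideanSpace.norm_eq]
      simp [hK.ne', Real.sq_sqrt hK.le]
    · simp
    · intro P Q hPQ hadj
      have hne' : cl P ≠ cl Q := by
        intro h
        apply hadj
        refine (SimpleGraph.fromRel_adj _ _ _).2 ⟨hPQ, Or.inl ?_⟩
        exact (hB _ (cl P).2).2.1 (hcl P) (h ▸ hcl Q) (fun h => hPQ (Subtype.ext h))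
      rw [EuclideanSpace.inner_single_left]
      simp [hne']
    · intro P
      rw [EuclideanSpace.inner_single_right]
      simp [hK.le, hK.ne']
  · rintro t ⟨d, c, u, hc, hu, huv, ht⟩
    have hsum := sum_inner_sq_le hS c u hc hu huv
    obtain ⟨P, hP⟩ := hne
    have ht0 : 0 ≤ t := by
      by_contra h
      have := ht ⟨P, hP⟩
      nlinarith [sq_nonneg (inner ℝ c (u ⟨P, hP⟩))]
    rw [div_le_iff₀ hn', ← hcS]
    calc (Fintype.card S : ℝ) = ∑ _i : S, (1 : ℝ) := by simp
      _ ≤ ∑ i, t * (inner ℝ c (u i)) ^ 2 := Finset.sum_le_sum fun i _ => ht i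
      _ = t * ∑ i, (inner ℝ c (u i)) ^ 2 := by rw [Finset.mul_sum]
      _ ≤ t * n := by gcongr

end Lovasz

/-! ### Projectors on lines -/

section Lines

variable {n : ℕ}

theorem lineProj_apply_self (v : QSpace n) : lineProj v v = v :=
  Submodule.starProjection_eq_self_iff.2 (Submodule.mem_span_singleton_self v)

theorem lineProj_isRankOneProjector {v : QSpace n} (hv : v ≠ 0) :
    IsRankOneProjector (lineProj v) := by
  refine ⟨isStarProjection_starProjection, ?_⟩
  have h : LinearMap.range (lineProj v).toLinearMap = ℂ ∙ v :=
    Submodule.range_starProjection (ℂ ∙ v)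
  rw [h, finrank_span_singleton hv]

theorem lineProj_smul {c : ℂ} (hc : c ≠ 0) (v : QSpace n) : lineProj (c • v) = lineProj v := by
  rw [lineProj, lineProj, Submodule.starProjection_inj,
    Submodule.span_singleton_smul_eq (IsUnit.mk0 c hc)]

theorem lineProj_mul_eq_zero {v w : QSpace n} (h : inner ℂ v w = 0) :
    lineProj v * lineProj w = 0 := by
  refine Submodule.starProjection_comp_starProjection_eq_zero_iff.2 ?_
  rw [Submodule.isOrtho_span]
  rintro _ rfl _ rfl
  exact h

theorem exists_smul_of_lineProj_eq {v w : QSpace n} (h : lineProj v = lineProj w) :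
    ∃ c : ℂ, v = c • w := by
  have hv : v ∈ ℂ ∙ w := Submodule.starProjection_eq_self_iff.1
    ((congrArg (fun T : QOp n => T v) h).symm.trans (lineProj_apply_self v))
  obtain ⟨c, hc⟩ := Submodule.mem_span_singleton.1 hv
  exact ⟨c, hc.symm⟩

theorem lineProj_ne_of_inner_eq_zero {v w : QSpace n} (hv : v ≠ 0) (h : inner ℂ v w = 0) :
    lineProj v ≠ lineProj w := by
  intro hvw
  obtain ⟨c, hc⟩ := exists_smul_of_lineProj_eq hvw.symm
  rw [hc, inner_smul_right] at h
  rcases mul_eq_zero.1 h with h | h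
  · rw [h, zero_smul] at hc
    obtain ⟨c', hc'⟩ := exists_smul_of_lineProj_eq hvw
    rw [hc, smul_zero] at hc'
    exact hv hc'
  · exact hv (inner_self_eq_zero.1 h)

theorem isMeasurementBasis_range {ι : Type*} [Fintype ι] (v : ι → QSpace n)
    (hv : ∀ i, v i ≠ 0) (h : ∀ i j, i ≠ j → inner ℂ (v i) (v j) = 0) (hc : Fintype.card ι = n) :
    IsMeasurementBasis (Set.range fun i => lineProj (v i)) := by
  have hinj : Function.Injective fun i => lineProj (v i) := by
    intro i j hij
    by_contra hne
    exact lineProj_ne_of_inner_eq_zero (hv i) (h i j hne) hij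
  refine ⟨?_, ?_, Set.finite_range _, ?_⟩
  · rintro _ ⟨i, rfl⟩
    exact lineProj_isRankOneProjector (hv i)
  · rintro _ ⟨i, rfl⟩ _ ⟨j, rfl⟩ hne
    exact lineProj_mul_eq_zero (h i j fun hij => hne (by rw [hij]))
  · rw [← Set.image_univ, Set.ncard_image_of_injective _ hinj, Set.ncard_univ,
      Nat.card_eq_fintype_card, hc]

/-- The resolution of the identity is checked entrywise. Orthogonality is not assumed: Bob has n²/2
vectors of squared norm 2/n, so his effects are not projectors onto a basis. -/
theorem sum_rankOne_eq_one {ι : Type*} [Fintype ι] (v : ι → QSpace n)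
    (h : ∀ s t, ∑ i, v i s * star (v i t) = if s = t then 1 else 0) :
    ∑ i, InnerProductSpace.rankOne ℂ (v i) (v i) = 1 := by
  ext w s
  have h1 : ∀ i, ((InnerProductSpace.rankOne ℂ (v i) (v i)) w) s
      = ∑ t, (v i s * star (v i t)) * w t := by
    intro i
    rw [InnerProductSpace.rankOne_apply]
    simp only [PiLp.smul_apply, smul_eq_mul, PiLp.inner_apply, RCLike.inner_apply, Finset.sum_mul]
    refine Finset.sum_congr rfl fun t _ => ?_
    simp
    ring
  have h2 : ((∑ i, InnerProductSpace.rankOne ℂ (v i) (v i)) w) s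
      = ∑ i, ((InnerProductSpace.rankOne ℂ (v i) (v i)) w) s := by
    simp
  rw [h2, Finset.sum_congr rfl fun i _ => h1 i, Finset.sum_comm]
  simp_rw [← Finset.sum_mul, h]
  simp

end Lines

/-! ### Signs and the inner product of bit strings -/

/-- The sign `(-1) ^ z`. -/
def sgn (z : ZMod 2) : ℂ := (-1) ^ z.val

theorem zmod_two_cases (z : ZMod 2) : z = 0 ∨ z = 1 := by
  revert z
  decide

theorem sgn_zero : sgn 0 = 1 := by simp [sgn]

theorem sgn_one : sgn 1 = -1 := by simp [sgn, ZMod.val_one]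

theorem sgn_add (z w : ZMod 2) : sgn (z + w) = sgn z * sgn w := by
  have h : (1 : ZMod 2) + 1 = 0 := by decide
  rcases zmod_two_cases z with rfl | rfl <;> rcases zmod_two_cases w with rfl | rfl <;>
    simp [sgn_zero, sgn_one, h]

theorem sgn_ne_zero (z : ZMod 2) : sgn z ≠ 0 := by
  rcases zmod_two_cases z with rfl | rfl <;> simp [sgn_zero, sgn_one]

theorem sgn_mul_self (z : ZMod 2) : sgn z * sgn z = 1 := by
  rw [← sgn_add, CharTwo.add_self_eq_zero, sgn_zero]

theorem star_sgn (z : ZMod 2) : star (sgn z) = sgn z := by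
  rcases zmod_two_cases z with rfl | rfl <;> simp [sgn_zero, sgn_one]

theorem sgn_injective : Function.Injective sgn := by
  intro z w h
  rcases zmod_two_cases z with rfl | rfl <;> rcases zmod_two_cases w with rfl | rfl <;>
    first | rfl | norm_num [sgn_zero, sgn_one] at h

theorem bitDot_comm (m s t : ℕ) : bitDot m s t = bitDot m t s := by
  simp [bitDot, Bool.and_comm]

theorem bitDot_zero (m s : ℕ) : bitDot m s 0 = 0 := by
  simp [bitDot]

theorem bitDot_xor (m s a b : ℕ) : bitDot m s (a ^^^ b) = bitDot m s a + bitDot m s b := by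
  rw [bitDot, bitDot, bitDot, ← Finset.sum_add_distrib]
  refine Finset.sum_congr rfl fun r _ => ?_
  rw [Nat.testBit_xor]
  have h : (1 : ZMod 2) + 1 = 0 := by decide
  cases s.testBit r <;> cases a.testBit r <;> cases b.testBit r <;> simp [h]

theorem xor_bitDot (m s t a : ℕ) : bitDot m (s ^^^ t) a = bitDot m s a + bitDot m t a := by
  rw [bitDot_comm, bitDot_xor, bitDot_comm, bitDot_comm m a t]

/-- Nondegeneracy of the pairing: pair s with the string whose only bit is a set bit of s. -/
theorem exists_bitDot_eq_one {m s : ℕ} (hs : s < 2 ^ m) (h0 : s ≠ 0) :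
    ∃ b : Fin (2 ^ m), bitDot m s b = 1 := by
  obtain ⟨r, hr⟩ := Nat.exists_testBit_ne_of_ne h0
  rw [Nat.zero_testBit] at hr
  have hr1 : s.testBit r = true := by simpa using hr
  have hrm : r < m := by
    by_contra h
    rw [Nat.testBit_lt_two_pow (hs.trans_le (Nat.pow_le_pow_right two_pos (not_lt.1 h)))] at hr1
    exact absurd hr1 (by simp)
  refine ⟨⟨2 ^ r, Nat.pow_lt_pow_right one_lt_two hrm⟩, ?_⟩
  rw [bitDot, Finset.sum_eq_single r]
  · simp [hr1]
  · intro t _ htr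
    simp [htr.symm]
  · intro h
    exact absurd (Finset.mem_range.2 hrm) h

/-- Bitwise sum modulo 2. -/
def bitXor {m : ℕ} (a b : Fin (2 ^ m)) : Fin (2 ^ m) := ⟨a ^^^ b, Nat.xor_lt_two_pow a.2 b.2⟩

theorem bitXor_bitXor_self {m : ℕ} (a b : Fin (2 ^ m)) : bitXor (bitXor a b) b = a := by
  apply Fin.ext
  simp [bitXor]

theorem xor_val_ne_zero {m : ℕ} {s t : Fin (2 ^ m)} (h : s ≠ t) : (s : ℕ) ^^^ (t : ℕ) ≠ 0 :=
  fun h0 => h (Fin.ext (Nat.xor_eq_zero_iff.1 h0))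

/-- Translation by a string c with s · c = 1 permutes the summands and flips every sign. -/
theorem sum_sgn_bitDot {m s : ℕ} (hs : s < 2 ^ m) (h0 : s ≠ 0) :
    ∑ b : Fin (2 ^ m), sgn (bitDot m s b) = 0 := by
  obtain ⟨c, hc⟩ := exists_bitDot_eq_one hs h0
  have h : ∑ b : Fin (2 ^ m), sgn (bitDot m s b)
      = ∑ b : Fin (2 ^ m), sgn (bitDot m s (bitXor b c)) :=
    (Equiv.sum_comp (Function.Involutive.toPerm (fun b => bitXor b c)
      fun b => bitXor_bitXor_self b c) fun b : Fin (2 ^ m) => sgn (bitDot m s b)).symm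
  have h1 : ∀ b : Fin (2 ^ m), sgn (bitDot m s (bitXor b c)) = -sgn (bitDot m s b) := by
    intro b
    rw [bitXor, bitDot_xor, hc, sgn_add, sgn_one, mul_neg_one]
  simp_rw [h1, Finset.sum_neg_distrib] at h
  exact self_eq_neg.1 h

/-- Orthogonality of the characters. -/
theorem sum_sgn_bitDot_add {m : ℕ} (s t : Fin (2 ^ m)) :
    ∑ b : Fin (2 ^ m), sgn (bitDot m s b + bitDot m t b) = if s = t then 2 ^ m else 0 := by
  split_ifs with h
  · subst h
    simp [CharTwo.add_self_eq_zero, sgn_zero]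
  · simp_rw [← xor_bitDot]
    exact sum_sgn_bitDot (Nat.xor_lt_two_pow s.2 t.2) (xor_val_ne_zero h)

/-! ### Alice's vectors -/

theorem sqrt_two_pow_mul_self (m : ℕ) :
    (Real.sqrt (2 ^ m) : ℂ) * (Real.sqrt (2 ^ m) : ℂ) = 2 ^ m := by
  rw [← Complex.ofReal_mul, Real.mul_self_sqrt (by positivity)]
  simp

theorem sqrt_two_pow_ne_zero (m : ℕ) : (Real.sqrt (2 ^ m) : ℂ) ≠ 0 := by
  intro h
  have h1 := sqrt_two_pow_mul_self m
  rw [h, zero_mul] at h1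
  exact pow_ne_zero m two_ne_zero h1.symm

theorem hadamardEntry_eq (m s t : ℕ) :
    hadamardEntry m s t = sgn (bitDot m s t) / (Real.sqrt (2 ^ m) : ℂ) := rfl

/-- The normalized sign vector with the signs `(-1) ^ x`. -/
noncomputable def signVec (m : ℕ) (x : Fin (2 ^ m) → ZMod 2) : QSpace (2 ^ m) :=
  WithLp.toLp 2 fun s => sgn (x s) / (Real.sqrt (2 ^ m) : ℂ)

/-- The character `s ↦ s · a`. -/
def bitChar (m : ℕ) (a : Fin (2 ^ m)) : Fin (2 ^ m) → ZMod 2 := fun s => bitDot m s a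

theorem bitChar_bitXor {m : ℕ} (a b : Fin (2 ^ m)) :
    bitChar m (bitXor a b) = bitChar m a + bitChar m b :=
  funext fun s => bitDot_xor m s a b

/-- Alice's bases thus correspond to cosets of the group of characters, with strings taken up to
complement. -/
theorem aliceVec_eq (m : ℕ) (x : Fin (2 ^ m) → ZMod 2) (a : Fin (2 ^ m)) :
    aliceVec m x a = signVec m (x + bitChar m a) := by
  ext s
  simp only [aliceVec, signVec, hadamardEntry_eq, Pi.add_apply, sgn_add, bitChar]
  rw [← mul_div_assoc]
  rfl

theorem inner_signVec (m : ℕ) (x y : Fin (2 ^ m) → ZMod 2) :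
    inner ℂ (signVec m x) (signVec m y) = (∑ s, sgn (x s + y s)) / 2 ^ m := by
  simp only [signVec, PiLp.inner_apply, RCLike.inner_apply, Finset.sum_div]
  refine Finset.sum_congr rfl fun s _ => ?_
  rw [sgn_add, ← sqrt_two_pow_mul_self, map_div₀, Complex.conj_ofReal, starRingEnd_apply, star_sgn]
  ring

theorem signVec_ne_zero (m : ℕ) (x : Fin (2 ^ m) → ZMod 2) : signVec m x ≠ 0 := by
  intro h
  have := inner_signVec m x x
  rw [h, inner_zero_left] at this
  simp [CharTwo.add_self_eq_zero, sgn_zero] at this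

theorem inner_aliceVec_of_ne (m : ℕ) (x : Fin (2 ^ m) → ZMod 2) {a b : Fin (2 ^ m)} (h : a ≠ b) :
    inner ℂ (aliceVec m x a) (aliceVec m x b) = 0 := by
  rw [aliceVec_eq, aliceVec_eq, inner_signVec]
  have h1 : ∀ s : Fin (2 ^ m), (x + bitChar m a) s + (x + bitChar m b) s
      = bitDot m a s + bitDot m b s := by
    intro s
    simp only [Pi.add_apply, bitChar]
    rw [add_add_add_comm, CharTwo.add_self_eq_zero, zero_add, bitDot_comm, bitDot_comm m s b]
  simp_rw [h1, sum_sgn_bitDot_add, if_neg h, zero_div]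

theorem aliceBasis_eq_range (m : ℕ) (x : Fin (2 ^ m) → ZMod 2) :
    aliceBasis m x = Set.range fun a => lineProj (aliceVec m x a) := by
  ext P
  simp [aliceBasis, eq_comm]

theorem aliceBasis_isMeasurementBasis (m : ℕ) (x : Fin (2 ^ m) → ZMod 2) :
    IsMeasurementBasis (aliceBasis m x) := by
  rw [aliceBasis_eq_range]
  refine isMeasurementBasis_range _ (fun a => ?_) (fun a b h => inner_aliceVec_of_ne m x h)
    (Fintype.card_fin _)
  rw [aliceVec_eq]
  exact signVec_ne_zero m _

theorem sum_rankOne_aliceVec (m : ℕ) (x : Fin (2 ^ m) → ZMod 2) :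
    ∑ a, InnerProductSpace.rankOne ℂ (aliceVec m x a) (aliceVec m x a) = 1 := by
  refine sum_rankOne_eq_one _ fun s t => ?_
  have h : ∀ a, aliceVec m x a s * star (aliceVec m x a t)
      = sgn (x s + x t) / 2 ^ m * sgn (bitDot m s a + bitDot m t a) := by
    intro a
    rw [aliceVec_eq, ← sqrt_two_pow_mul_self]
    simp only [signVec, Pi.add_apply, bitChar, sgn_add]
    rw [star_div₀, star_mul', star_sgn, star_sgn, Complex.star_def, Complex.conj_ofReal]
    ring
  simp_rw [h, ← Finset.mul_sum, sum_sgn_bitDot_add]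
  split_ifs with hst
  · subst hst
    rw [CharTwo.add_self_eq_zero, sgn_zero]
    field_simp
  · simp

/-- Two proportional sign vectors have a constant ratio ±1, so the lines are strings up to
complement. -/
theorem lineProj_signVec_eq_iff {m : ℕ} {x y : Fin (2 ^ m) → ZMod 2} :
    lineProj (signVec m x) = lineProj (signVec m y) ↔ ∃ c, ∀ s, x s = y s + c := by
  constructor
  · intro h
    obtain ⟨k, hk⟩ := exists_smul_of_lineProj_eq h
    have h1 : ∀ s, sgn (x s + y s) = k := by
      intro s
      have h2 : sgn (x s) / (Real.sqrt (2 ^ m) : ℂ)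
          = k * (sgn (y s) / (Real.sqrt (2 ^ m) : ℂ)) :=
        congrArg (fun v : QSpace (2 ^ m) => v s) hk
      rw [← mul_div_assoc, div_left_inj' (sqrt_two_pow_ne_zero m)] at h2
      rw [sgn_add, h2, mul_assoc, sgn_mul_self, mul_one]
    refine ⟨x 0 + y 0, fun s => ?_⟩
    rw [← sgn_injective ((h1 s).trans (h1 0).symm), add_comm (x s), ← add_assoc,
      CharTwo.add_self_eq_zero, zero_add]
  · rintro ⟨c, hc⟩
    have h : signVec m x = sgn c • signVec m y := by
      ext s
      simp only [signVec, PiLp.smul_apply, smul_eq_mul, hc, sgn_add]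
      ring
    rw [h, lineProj_smul (sgn_ne_zero c)]

/-! ### The matchings -/

theorem half_two_pow_add_self {m : ℕ} (hm : 1 ≤ m) : 2 ^ m / 2 + 2 ^ m / 2 = 2 ^ m := by
  have : 2 ∣ 2 ^ m := dvd_pow_self 2 (by omega)
  omega

/-- The edge of `M_k` at the left point `i`. -/
def hmEdge (m : ℕ) (k i : Fin (2 ^ m / 2)) : Fin (2 ^ m) × Fin (2 ^ m) :=
  (⟨i, by omega⟩, ⟨2 ^ m / 2 + (i + k) % (2 ^ m / 2), by
    have := Nat.mod_lt ((i : ℕ) + k) i.pos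
    omega⟩)

theorem hmEdge_injective (m : ℕ) (k : Fin (2 ^ m / 2)) : Function.Injective (hmEdge m k) := by
  intro i j h
  have h1 : (i : ℕ) = j := congrArg (fun e : Fin (2 ^ m) × Fin (2 ^ m) => (e.1 : ℕ)) h
  exact Fin.ext h1

theorem mem_hmMatching_iff {m : ℕ} {k : Fin (2 ^ m / 2)} {e : Fin (2 ^ m) × Fin (2 ^ m)} :
    e ∈ hmMatching m k ↔ ∃ i, hmEdge m k i = e := by
  simp only [hmMatching, Finset.mem_filter, Finset.mem_univ, true_and]
  constructor
  · rintro ⟨h1, h2⟩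
    exact ⟨⟨e.1, h1⟩, Prod.ext (Fin.ext rfl) (Fin.ext h2.symm)⟩
  · rintro ⟨i, rfl⟩
    exact ⟨i.2, rfl⟩

theorem hmMatching_eq_image (m : ℕ) (k : Fin (2 ^ m / 2)) :
    hmMatching m k = Finset.univ.image (hmEdge m k) := by
  ext e
  simp [mem_hmMatching_iff]

theorem sum_hmMatching {M : Type*} [AddCommMonoid M] (m : ℕ) (k : Fin (2 ^ m / 2))
    (f : Fin (2 ^ m) × Fin (2 ^ m) → M) :
    ∑ e ∈ hmMatching m k, f e = ∑ i, f (hmEdge m k i) := by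
  rw [hmMatching_eq_image, Finset.sum_image fun i _ j _ h => hmEdge_injective m k h]

theorem hmEdge_ne {m : ℕ} (k i : Fin (2 ^ m / 2)) : (hmEdge m k i).1 ≠ (hmEdge m k i).2 := by
  intro h
  have h1 : (i : ℕ) = 2 ^ m / 2 + (i + k) % (2 ^ m / 2) := congrArg Fin.val h
  omega

theorem Fin.add_mod_injective {h : ℕ} (k : Fin h) :
    Function.Injective fun i : Fin h => (⟨(i + k) % h, Nat.mod_lt _ i.pos⟩ : Fin h) := by
  intro i j hij
  have h1 : ((i : ℕ) + k) % h = (j + k) % h := congrArg Fin.val hij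
  have h2 : (i : ℕ) ≡ j [MOD h] := Nat.ModEq.add_right_cancel' (k : ℕ) h1
  exact Fin.ext (Nat.ModEq.eq_of_lt_of_lt h2 i.2 j.2)

/-- Every point lies on exactly one edge of the matching `M_k`. -/
theorem exists_unique_hmEdge {m : ℕ} (hm : 1 ≤ m) (k : Fin (2 ^ m / 2)) (s : Fin (2 ^ m)) :
    ∃ i, (s = (hmEdge m k i).1 ∨ s = (hmEdge m k i).2) ∧
      ∀ j, (s = (hmEdge m k j).1 ∨ s = (hmEdge m k j).2) → j = i := by
  have h2 := half_two_pow_add_self hm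
  have hsh := Fin.add_mod_injective k
  by_cases hs : (s : ℕ) < 2 ^ m / 2
  · refine ⟨⟨s, hs⟩, Or.inl (Fin.ext rfl), ?_⟩
    rintro j (h | h)
    · have h1 : (s : ℕ) = j := congrArg Fin.val h
      exact Fin.ext h1.symm
    · have h1 : (s : ℕ) = 2 ^ m / 2 + (j + k) % (2 ^ m / 2) := congrArg Fin.val h
      omega
  · have hlt : (s : ℕ) - 2 ^ m / 2 < 2 ^ m / 2 := by omega
    obtain ⟨i, hi⟩ := (Finite.injective_iff_surjective.1 hsh) ⟨(s : ℕ) - 2 ^ m / 2, hlt⟩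
    have hi1 : ((i : ℕ) + k) % (2 ^ m / 2) = (s : ℕ) - 2 ^ m / 2 := congrArg Fin.val hi
    refine ⟨i, Or.inr (Fin.ext ?_), ?_⟩
    · change (s : ℕ) = 2 ^ m / 2 + (i + k) % (2 ^ m / 2)
      omega
    · rintro j (h | h)
      · have h1 : (s : ℕ) = j := congrArg Fin.val h
        omega
      · have h1 : (s : ℕ) = 2 ^ m / 2 + (j + k) % (2 ^ m / 2) := congrArg Fin.val h
        apply hsh
        apply Fin.ext
        change ((j : ℕ) + k) % (2 ^ m / 2) = (i + k) % (2 ^ m / 2)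
        omega

/-- The matchings are pairwise disjoint. -/
theorem hmEdge_eq_matching {m : ℕ} {k l i j : Fin (2 ^ m / 2)}
    (h : hmEdge m k i = hmEdge m l j) : k = l := by
  have h1 : (i : ℕ) = j := congrArg (fun e : Fin (2 ^ m) × Fin (2 ^ m) => (e.1 : ℕ)) h
  have h2 : 2 ^ m / 2 + ((i : ℕ) + k) % (2 ^ m / 2) = 2 ^ m / 2 + ((j : ℕ) + l) % (2 ^ m / 2) :=
    congrArg (fun e : Fin (2 ^ m) × Fin (2 ^ m) => (e.2 : ℕ)) h
  rw [← Fin.ext h1] at h2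
  apply Fin.add_mod_injective i
  apply Fin.ext
  change ((k : ℕ) + i) % (2 ^ m / 2) = (l + i) % (2 ^ m / 2)
  rw [add_comm (k : ℕ), add_comm (l : ℕ)]
  omega

/-! ### Bob's vectors -/

/-- The vector `|i⟩ + (-1) ^ σ |j⟩` for `e = (i, j)`. -/
noncomputable def pairVec (m : ℕ) (e : Fin (2 ^ m) × Fin (2 ^ m)) (σ : ZMod 2) : QSpace (2 ^ m) :=
  EuclideanSpace.single e.1 1 + EuclideanSpace.single e.2 (sgn σ)

theorem inner_pairVec (m : ℕ) (v : QSpace (2 ^ m)) (e : Fin (2 ^ m) × Fin (2 ^ m)) (σ : ZMod 2) :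
    inner ℂ v (pairVec m e σ) = star (v e.1) + sgn σ * star (v e.2) := by
  rw [pairVec, inner_add_right, EuclideanSpace.inner_single_right,
    EuclideanSpace.inner_single_right, one_mul]
  rfl

theorem pairVec_apply (m : ℕ) (e : Fin (2 ^ m) × Fin (2 ^ m)) (σ : ZMod 2) (s : Fin (2 ^ m)) :
    pairVec m e σ s = (if s = e.1 then 1 else 0) + if s = e.2 then sgn σ else 0 := by
  simp [pairVec, PiLp.single_apply]

theorem pairVec_ne_zero {m : ℕ} {e : Fin (2 ^ m) × Fin (2 ^ m)} (he : e.1 ≠ e.2) (σ : ZMod 2) :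
    pairVec m e σ ≠ 0 := by
  intro h
  have h1 := pairVec_apply m e σ e.1
  rw [h, if_pos rfl, if_neg he] at h1
  simp at h1

/-- Up to a scalar the vector depends on b only through the bit (i ⊕ j) · b. The n labels b
therefore give only two lines per edge. -/
theorem bobVec_eq {m : ℕ} {e : Fin (2 ^ m) × Fin (2 ^ m)} (he : e.1 ≠ e.2) (b : Fin (2 ^ m)) :
    bobVec m e b = (sgn (bitDot m e.1 b) / (Real.sqrt (2 ^ m) : ℂ)) •
      pairVec m e (bitDot m ((e.1 : ℕ) ^^^ (e.2 : ℕ)) b) := by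
  ext s
  rw [PiLp.smul_apply, pairVec_apply, xor_bitDot, sgn_add, smul_eq_mul]
  change (if s = e.1 ∨ s = e.2 then hadamardEntry m s b else 0) = _
  by_cases h1 : s = e.1
  · subst h1
    simp [he, hadamardEntry_eq]
  · by_cases h2 : s = e.2
    · subst h2
      rw [if_pos (Or.inr rfl), if_neg h1, if_pos rfl, zero_add, hadamardEntry_eq, div_mul_eq_mul_div,
        ← mul_assoc, sgn_mul_self, one_mul]
    · simp [h1, h2]

theorem lineProj_bobVec {m : ℕ} {e : Fin (2 ^ m) × Fin (2 ^ m)} (he : e.1 ≠ e.2)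
    (b : Fin (2 ^ m)) :
    lineProj (bobVec m e b) =
      lineProj (pairVec m e (bitDot m ((e.1 : ℕ) ^^^ (e.2 : ℕ)) b)) := by
  rw [bobVec_eq he, lineProj_smul (div_ne_zero (sgn_ne_zero _) (sqrt_two_pow_ne_zero m))]

/-- On one edge, opposite signs cancel; different edges of a matching have disjoint supports. -/
theorem inner_pairVec_eq_zero {m : ℕ} (hm : 1 ≤ m) (k : Fin (2 ^ m / 2))
    {p q : Fin (2 ^ m / 2) × ZMod 2} (hpq : p ≠ q) :
    inner ℂ (pairVec m (hmEdge m k p.1) p.2) (pairVec m (hmEdge m k q.1) q.2) = 0 := by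
  rw [inner_pairVec]
  by_cases h : p.1 = q.1
  · have hne := hmEdge_ne k q.1
    have hσ : p.2 ≠ q.2 := fun h' => hpq (Prod.ext h h')
    rw [h, pairVec_apply, pairVec_apply, if_pos rfl, if_pos rfl, if_neg hne, if_neg hne.symm]
    have h1 : sgn q.2 * star (sgn p.2) = -1 := by
      rw [star_sgn, ← sgn_add]
      have : q.2 + p.2 = 1 := by
        rcases zmod_two_cases p.2 with h1 | h1 <;> rcases zmod_two_cases q.2 with h2 | h2 <;>
          simp_all
      rw [this, sgn_one]
    simp only [add_zero, zero_add, star_one, h1]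
    ring
  · have h0 : ∀ s, s = (hmEdge m k q.1).1 ∨ s = (hmEdge m k q.1).2 →
        pairVec m (hmEdge m k p.1) p.2 s = 0 := by
      intro s hs
      obtain ⟨i, -, hi⟩ := exists_unique_hmEdge hm k s
      have h1 : ¬ s = (hmEdge m k p.1).1 := fun h' => h ((hi _ (Or.inl h')).trans (hi _ hs).symm)
      have h2 : ¬ s = (hmEdge m k p.1).2 := fun h' => h ((hi _ (Or.inr h')).trans (hi _ hs).symm)
      rw [pairVec_apply, if_neg h1, if_neg h2, add_zero]
    rw [h0 _ (Or.inl rfl), h0 _ (Or.inr rfl)]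
    simp

/-- Indexing by edge and sign lists each line once. Both signs occur because i ⊕ j ≠ 0. -/
theorem bobBasis_eq_range (m : ℕ) (k : Fin (2 ^ m / 2)) :
    bobBasis m k = Set.range fun p : Fin (2 ^ m / 2) × ZMod 2 =>
      lineProj (pairVec m (hmEdge m k p.1) p.2) := by
  ext P
  constructor
  · rintro ⟨e, he, b, rfl⟩
    obtain ⟨i, rfl⟩ := mem_hmMatching_iff.1 he
    exact ⟨(i, _), (lineProj_bobVec (hmEdge_ne k i) b).symm⟩
  · rintro ⟨⟨i, σ⟩, rfl⟩
    have hne := hmEdge_ne k i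
    obtain ⟨b, hb⟩ : ∃ b : Fin (2 ^ m),
        bitDot m (((hmEdge m k i).1 : ℕ) ^^^ ((hmEdge m k i).2 : ℕ)) b = σ := by
      rcases zmod_two_cases σ with rfl | rfl
      · exact ⟨0, by simpa using bitDot_zero m _⟩
      · exact exists_bitDot_eq_one (Nat.xor_lt_two_pow (Fin.is_lt _) (Fin.is_lt _))
          (xor_val_ne_zero hne)
    refine ⟨_, mem_hmMatching_iff.2 ⟨i, rfl⟩, b, ?_⟩
    rw [lineProj_bobVec hne, hb]

theorem bobBasis_isMeasurementBasis {m : ℕ} (hm : 1 ≤ m) (k : Fin (2 ^ m / 2)) :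
    IsMeasurementBasis (bobBasis m k) := by
  rw [bobBasis_eq_range]
  refine isMeasurementBasis_range _ (fun p => pairVec_ne_zero (hmEdge_ne k p.1) p.2)
    (fun p q h => inner_pairVec_eq_zero hm k h) ?_
  rw [Fintype.card_prod, Fintype.card_fin, ZMod.card, mul_two, half_two_pow_add_self hm]

theorem sum_rankOne_bobVec {m : ℕ} (hm : 1 ≤ m) (k : Fin (2 ^ m / 2)) :
    ∑ e ∈ hmMatching m k, ∑ b,
      InnerProductSpace.rankOne ℂ (bobVec m e b) (bobVec m e b) = 1 := by
  rw [sum_hmMatching, ← Fintype.sum_prod_type'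
    (fun i b => InnerProductSpace.rankOne ℂ (bobVec m (hmEdge m k i) b)
      (bobVec m (hmEdge m k i) b))]
  refine sum_rankOne_eq_one (fun p : Fin (2 ^ m / 2) × Fin (2 ^ m) =>
    bobVec m (hmEdge m k p.1) p.2) fun s t => ?_
  rw [Fintype.sum_prod_type]
  -- Only the edge through s contributes to row s; within it, orthogonality of characters kills the
  -- entries with t ≠ s.
  obtain ⟨i, hi, huniq⟩ := exists_unique_hmEdge hm k s
  rw [Finset.sum_eq_single i]
  · have h : ∀ b, bobVec m (hmEdge m k i) b s * star (bobVec m (hmEdge m k i) b t)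
        = (if t = (hmEdge m k i).1 ∨ t = (hmEdge m k i).2 then (2 ^ m : ℂ)⁻¹ else 0) *
          sgn (bitDot m s b + bitDot m t b) := by
      intro b
      simp only [bobVec, if_pos hi, hadamardEntry_eq]
      split_ifs with ht
      · rw [star_div₀, star_sgn, Complex.star_def, Complex.conj_ofReal, sgn_add,
          ← sqrt_two_pow_mul_self]
        ring
      · simp
    simp_rw [h, ← Finset.mul_sum, sum_sgn_bitDot_add]
    by_cases hst : s = t
    · subst hst
      rw [if_pos hi, if_pos rfl, if_pos rfl, inv_mul_cancel₀ (pow_ne_zero _ two_ne_zero)]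
    · rw [if_neg hst, if_neg hst, mul_zero]
  · intro j _ hj
    refine Finset.sum_eq_zero fun b _ => ?_
    have h : ¬ (s = (hmEdge m k j).1 ∨ s = (hmEdge m k j).2) := fun h => hj (huniq j h)
    simp only [bobVec, if_neg h, zero_mul]
  · intro h
    exact absurd (Finset.mem_univ _) h

/-! ### Winning and orthogonality -/

theorem sgn_add_sgn_eq_zero {z w : ZMod 2} (h : z ≠ w) : sgn z + sgn w = 0 := by
  rcases zmod_two_cases z with rfl | rfl <;> rcases zmod_two_cases w with rfl | rfl <;>
    simp_all [sgn_zero, sgn_one]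

/-- The overlap of the vectors of Alice and Bob, without complex conjugation. -/
theorem sum_aliceVec_mul_bobVec (m : ℕ) (x : Fin (2 ^ m) → ZMod 2) (a b : Fin (2 ^ m))
    {e : Fin (2 ^ m) × Fin (2 ^ m)} (he : e.1 ≠ e.2) :
    ∑ s, aliceVec m x a s * bobVec m e b s =
      (sgn (x e.1 + bitDot m e.1 ((a : ℕ) ^^^ (b : ℕ))) +
        sgn (x e.2 + bitDot m e.2 ((a : ℕ) ^^^ (b : ℕ)))) / 2 ^ m := by
  have h : ∀ s, aliceVec m x a s * bobVec m e b s =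
      (if s = e.1 then sgn (x e.1 + bitDot m e.1 ((a : ℕ) ^^^ (b : ℕ))) / 2 ^ m else 0) +
      if s = e.2 then sgn (x e.2 + bitDot m e.2 ((a : ℕ) ^^^ (b : ℕ))) / 2 ^ m else 0 := by
    intro s
    have h1 : aliceVec m x a s * hadamardEntry m s b
        = sgn (x s + bitDot m s ((a : ℕ) ^^^ (b : ℕ))) / 2 ^ m := by
      rw [aliceVec_eq, hadamardEntry_eq, bitDot_xor, ← add_assoc, sgn_add _ (bitDot m s b),
        ← sqrt_two_pow_mul_self]
      simp only [signVec, Pi.add_apply, bitChar]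
      ring
    change aliceVec m x a s * (if s = e.1 ∨ s = e.2 then hadamardEntry m s b else 0) = _
    by_cases h2 : s = e.1
    · subst h2
      rw [if_pos (Or.inl rfl), if_pos rfl, if_neg he, add_zero, h1]
    · by_cases h3 : s = e.2
      · subst h3
        rw [if_pos (Or.inr rfl), if_neg h2, if_pos rfl, zero_add, h1]
      · rw [if_neg (not_or.2 ⟨h2, h3⟩), if_neg h2, if_neg h3, mul_zero, add_zero]
  simp_rw [h, Finset.sum_add_distrib, Finset.sum_ite_eq' Finset.univ, Finset.mem_univ, if_true]
  rw [add_div]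

theorem star_aliceVec (m : ℕ) (x : Fin (2 ^ m) → ZMod 2) (a s : Fin (2 ^ m)) :
    star (aliceVec m x a s) = aliceVec m x a s := by
  rw [aliceVec_eq]
  simp only [signVec]
  rw [star_div₀, star_sgn, Complex.star_def, Complex.conj_ofReal]

theorem star_bobVec (m : ℕ) (e : Fin (2 ^ m) × Fin (2 ^ m)) (b s : Fin (2 ^ m)) :
    star (bobVec m e b s) = bobVec m e b s := by
  simp only [bobVec, hadamardEntry_eq]
  split_ifs
  · rw [star_div₀, star_sgn, Complex.star_def, Complex.conj_ofReal]
  · exact star_zero _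

/-- In this form, winning means that the two signs in `sum_aliceVec_mul_bobVec` agree, and losing
that they cancel. -/
theorem winning_sum_eq (m : ℕ) (x : Fin (2 ^ m) → ZMod 2) (a b : Fin (2 ^ m))
    (e : Fin (2 ^ m) × Fin (2 ^ m)) :
    bitDot m ((a : ℕ) ^^^ (b : ℕ)) ((e.1 : ℕ) ^^^ (e.2 : ℕ)) = x e.1 + x e.2 ↔
      x e.1 + bitDot m e.1 ((a : ℕ) ^^^ (b : ℕ)) = x e.2 + bitDot m e.2 ((a : ℕ) ^^^ (b : ℕ)) := by
  rw [bitDot_xor, bitDot_comm m _ e.1, bitDot_comm m _ e.2]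
  generalize bitDot m e.1 ((a : ℕ) ^^^ (b : ℕ)) = p
  generalize bitDot m e.2 ((a : ℕ) ^^^ (b : ℕ)) = q
  generalize x e.1 = y
  generalize x e.2 = z
  revert p q y z
  decide

/-- The projectors of losing answers are orthogonal. -/
theorem inner_aliceVec_bobVec_of_losing {m : ℕ} {x : Fin (2 ^ m) → ZMod 2} {k : Fin (2 ^ m / 2)}
    {a b : Fin (2 ^ m)} {e : Fin (2 ^ m) × Fin (2 ^ m)} (he : e ∈ hmMatching m k)
    (h : ¬ HMWins m x k a e b) : inner ℂ (aliceVec m x a) (bobVec m e b) = 0 := by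
  have hne : e.1 ≠ e.2 := by
    obtain ⟨i, rfl⟩ := mem_hmMatching_iff.1 he
    exact hmEdge_ne k i
  have h1 : inner ℂ (aliceVec m x a) (bobVec m e b) = ∑ s, aliceVec m x a s * bobVec m e b s := by
    rw [PiLp.inner_apply]
    refine Finset.sum_congr rfl fun s _ => ?_
    rw [RCLike.inner_apply, starRingEnd_apply, star_aliceVec, mul_comm]
  rw [h1, sum_aliceVec_mul_bobVec m x a b hne, sgn_add_sgn_eq_zero, zero_div]
  exact fun h' => h ⟨he, (winning_sum_eq m x a b e).2 h'⟩

theorem inner_prodVec_maxEntangled (m : ℕ) (x : Fin (2 ^ m) → ZMod 2) (a b : Fin (2 ^ m))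
    (e : Fin (2 ^ m) × Fin (2 ^ m)) :
    inner ℂ (prodVec (aliceVec m x a) (bobVec m e b)) (maxEntangled m) =
      (∑ s, aliceVec m x a s * bobVec m e b s) / (Real.sqrt (2 ^ m) : ℂ) := by
  rw [PiLp.inner_apply, Fintype.sum_prod_type, Finset.sum_div]
  refine Finset.sum_congr rfl fun s _ => ?_
  rw [Finset.sum_eq_single s]
  · rw [RCLike.inner_apply, starRingEnd_apply]
    simp only [prodVec, maxEntangled, if_true]
    rw [star_mul', star_aliceVec, star_bobVec]
    ring
  · intro t _ hts
    simp [maxEntangled, hts.symm]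
  · intro h
    exact absurd (Finset.mem_univ _) h

/-- The quantum strategy wins with probability one on all inputs. -/
theorem hmQuantumWinProb_eq_one {m : ℕ} (hm : 1 ≤ m) (x : Fin (2 ^ m) → ZMod 2)
    (k : Fin (2 ^ m / 2)) : hmQuantumWinProb m x k = 1 := by
  classical
  have hN : (2 : ℂ) ^ m ≠ 0 := pow_ne_zero _ two_ne_zero
  -- A winning outcome has probability 4/n³, and the indicator of winning is (1 + product of the two
  -- signs)/2. The product is then split into a factor depending on a and one depending on b.
  have hterm : ∀ (a : Fin (2 ^ m)) (i : Fin (2 ^ m / 2)) (b : Fin (2 ^ m)),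
      (((if HMWins m x k a (hmEdge m k i) b then
        ‖inner ℂ (prodVec (aliceVec m x a) (bobVec m (hmEdge m k i) b)) (maxEntangled m)‖ ^ 2
        else 0 : ℝ)) : ℂ) = 2 / (2 ^ m) ^ 3 +
          2 / (2 ^ m) ^ 3 * sgn (x (hmEdge m k i).1 + x (hmEdge m k i).2 +
            bitDot m (((hmEdge m k i).1 : ℕ) ^^^ ((hmEdge m k i).2 : ℕ)) a) *
          sgn (bitDot m (((hmEdge m k i).1 : ℕ) ^^^ ((hmEdge m k i).2 : ℕ)) b) := by
    intro a i b
    have hne := hmEdge_ne k i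
    have hmem : hmEdge m k i ∈ hmMatching m k := mem_hmMatching_iff.2 ⟨i, rfl⟩
    rw [inner_prodVec_maxEntangled, sum_aliceVec_mul_bobVec m x a b hne]
    generalize hmEdge m k i = e at *
    have hs : sgn (x e.1 + x e.2 + bitDot m ((e.1 : ℕ) ^^^ (e.2 : ℕ)) a) *
        sgn (bitDot m ((e.1 : ℕ) ^^^ (e.2 : ℕ)) b) =
        sgn (x e.1 + bitDot m e.1 ((a : ℕ) ^^^ (b : ℕ))) *
          sgn (x e.2 + bitDot m e.2 ((a : ℕ) ^^^ (b : ℕ))) := by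
      rw [← sgn_add, ← sgn_add, xor_bitDot, xor_bitDot, bitDot_xor, bitDot_xor]
      congr 1
      ring
    rw [mul_assoc, hs]
    by_cases hw : HMWins m x k a e b
    · have heq := (winning_sum_eq m x a b e).1 hw.2
      rw [if_pos hw, heq, sgn_mul_self, ← two_mul, norm_div, norm_div, norm_mul]
      have hsn : ‖sgn (x e.2 + bitDot m e.2 ((a : ℕ) ^^^ (b : ℕ)))‖ = 1 := by
        rcases zmod_two_cases (x e.2 + bitDot m e.2 ((a : ℕ) ^^^ (b : ℕ))) with h | h <;>
          simp [h, sgn_zero, sgn_one]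
      have hr := Real.sq_sqrt (show (0 : ℝ) ≤ 2 ^ m by positivity)
      rw [hsn, Complex.norm_real, Real.norm_eq_abs, div_pow, sq_abs, hr]
      simp only [norm_pow, Complex.norm_ofNat, mul_one]
      push_cast
      field_simp
      norm_num
    · rw [if_neg hw]
      have hz : x e.1 + bitDot m e.1 ((a : ℕ) ^^^ (b : ℕ)) ≠
          x e.2 + bitDot m e.2 ((a : ℕ) ^^^ (b : ℕ)) :=
        fun h => hw ⟨hmem, (winning_sum_eq m x a b e).2 h⟩
      have hz' := sgn_add_sgn_eq_zero hz
      rw [eq_neg_of_add_eq_zero_left hz', neg_mul, sgn_mul_self]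
      push_cast
      ring
  -- The nontrivial character in b sums to zero, leaving 2/n² for each of the n · n/2 pairs (a,
  -- edge).
  have hinner : ∀ (a : Fin (2 ^ m)) (i : Fin (2 ^ m / 2)),
      ∑ b, (((if HMWins m x k a (hmEdge m k i) b then
        ‖inner ℂ (prodVec (aliceVec m x a) (bobVec m (hmEdge m k i) b)) (maxEntangled m)‖ ^ 2
        else 0 : ℝ)) : ℂ) = 2 / (2 ^ m) ^ 2 := by
    intro a i
    simp_rw [hterm, Finset.sum_add_distrib, ← Finset.mul_sum,
      sum_sgn_bitDot (Nat.xor_lt_two_pow (Fin.is_lt (hmEdge m k i).1) (Fin.is_lt _))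
        (xor_val_ne_zero (hmEdge_ne k i))]
    simp only [Finset.sum_const, Finset.card_univ, Fintype.card_fin, nsmul_eq_mul, mul_zero,
      add_zero]
    push_cast
    field_simp
  apply Complex.ofReal_injective
  rw [hmQuantumWinProb]
  simp_rw [sum_hmMatching, Complex.ofReal_sum]
  convert (Finset.sum_congr rfl fun a _ => Finset.sum_congr rfl fun i _ => hinner a i).trans ?_
    using 1
  have hh : ((2 ^ m / 2 : ℕ) : ℂ) = 2 ^ m / 2 := by
    have h := congrArg (Nat.cast (R := ℂ)) (half_two_pow_add_self hm)
    push_cast at h ⊢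
    linear_combination h / 2
  simp only [Finset.sum_const, Finset.card_univ, Fintype.card_fin, nsmul_eq_mul]
  rw [hh, Complex.ofReal_one]
  push_cast
  field_simp

/-! ### No classical strategy -/

/-- Serves both the count of Bob's edges and the final estimate log n ≤ √n. -/
theorem two_mul_sq_lt_two_pow {m : ℕ} (hm : 17 ≤ m) : 2 * m ^ 2 < 2 ^ m := by
  induction m, hm using Nat.le_induction with
  | base => norm_num
  | succ m hm ih =>
    rw [pow_succ 2 m]
    nlinarith

/-- Parity constraints whose first points take many values cannot be met for all inputs by
answers from a small set. -/
theorem not_exists_parity_strategy {K V α : Type*} [Fintype K] [DecidableEq V] [Fintype α]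
    (f g : K → V) (hfg : ∀ k k', f k ≠ g k') (T : α → K → ZMod 2)
    (hcard : Fintype.card α < 2 ^ (Finset.univ.image f).card) :
    ¬ ∃ A : (V → ZMod 2) → α, ∀ x k, T (A x) k = x (f k) + x (g k) := by
  rintro ⟨A, hA⟩
  have hκ : ∀ v : Finset.univ.image f, ∃ k, f k = v := by
    rintro ⟨v, hv⟩
    obtain ⟨k, -, hk⟩ := Finset.mem_image.1 hv
    exact ⟨k, hk⟩
  choose κ hκ using hκ
  have hns : ¬ Function.Surjective fun (a : α) (v : Finset.univ.image f) => T a (κ v) := by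
    intro hs
    have := Fintype.card_le_of_surjective _ hs
    rw [Fintype.card_fun, Fintype.card_coe, ZMod.card] at this
    omega
  apply hns
  intro y
  -- The input is y on the values of f and zero elsewhere, in particular on the values of g, so the
  -- required parities reproduce y.
  let x : V → ZMod 2 := fun v => if hv : v ∈ Finset.univ.image f then y ⟨v, hv⟩ else 0
  refine ⟨A x, funext fun v => ?_⟩
  have h1 : x (f (κ v)) = y v := by
    rw [hκ v]
    exact dif_pos v.2
  have h2 : x (g (κ v)) = 0 := by
    refine dif_neg fun h => ?_
    obtain ⟨k, -, hk⟩ := Finset.mem_image.1 h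
    exact hfg k (κ v) hk
  exact (hA x (κ v)).trans (by rw [h1, h2, add_zero])

theorem hmEdge_fst_ne_snd {m : ℕ} (k i l j : Fin (2 ^ m / 2)) :
    (hmEdge m k i).1 ≠ (hmEdge m l j).2 := by
  intro h
  have h1 : (i : ℕ) = 2 ^ m / 2 + (j + l) % (2 ^ m / 2) := congrArg Fin.val h
  omega

theorem no_classical_strategy {m : ℕ} (hm : 17 ≤ m) :
    ¬ ∃ (A : (Fin (2 ^ m) → ZMod 2) → Fin (2 ^ m))
        (B : Fin (2 ^ m / 2) → (Fin (2 ^ m) × Fin (2 ^ m)) × Fin (2 ^ m)),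
        ∀ x k, HMWins m x k (A x) (B k).1 (B k).2 := by
  rintro ⟨A, B, hAB⟩
  choose i hi using fun k => mem_hmMatching_iff.1 (hAB 0 k).1
  let f : Fin (2 ^ m / 2) → Fin (2 ^ m) := fun k => (B k).1.1
  let g : Fin (2 ^ m / 2) → Fin (2 ^ m) := fun k => (B k).1.2
  have hfg : ∀ k k', f k ≠ g k' := by
    intro k k'
    simp only [f, g, ← hi]
    exact hmEdge_fst_ne_snd _ _ _ _
  have hT : ∀ x k, bitDot m ((A x : ℕ) ^^^ ((B k).2 : ℕ)) (((B k).1.1 : ℕ) ^^^ ((B k).1.2 : ℕ)) =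
      x (f k) + x (g k) := fun x k => (hAB x k).2
  have hf : (Finset.univ.image f).card ≤ m := by
    by_contra h
    refine not_exists_parity_strategy f g hfg (fun (a : Fin (2 ^ m)) k =>
      bitDot m ((a : ℕ) ^^^ ((B k).2 : ℕ)) (((B k).1.1 : ℕ) ^^^ ((B k).1.2 : ℕ))) ?_ ⟨A, hT⟩
    rw [Fintype.card_fin]
    exact Nat.pow_lt_pow_right one_lt_two (not_le.1 h)
  have hg : (Finset.univ.image g).card ≤ m := by
    by_contra h
    refine not_exists_parity_strategy g f (fun k k' => (hfg k' k).symm) (fun (a : Fin (2 ^ m)) k =>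
      bitDot m ((a : ℕ) ^^^ ((B k).2 : ℕ)) (((B k).1.1 : ℕ) ^^^ ((B k).1.2 : ℕ))) ?_
      ⟨A, fun x k => (hT x k).trans (add_comm _ _)⟩
    rw [Fintype.card_fin]
    exact Nat.pow_lt_pow_right one_lt_two (not_le.1 h)
  -- Edge-disjointness of the matchings makes Bob's n/2 edges distinct, which is too many for an m ×
  -- m grid of endpoints.
  have hinj : Function.Injective fun k => (f k, g k) := by
    intro k l h
    have h1 : (B k).1 = (B l).1 := Prod.ext (congrArg Prod.fst h) (congrArg Prod.snd h)
    rw [← hi, ← hi] at h1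
    exact hmEdge_eq_matching h1
  have hcard : 2 ^ m / 2 ≤ (Finset.univ.image f ×ˢ Finset.univ.image g).card := by
    have h := Finset.card_le_card_of_injOn (s := Finset.univ)
      (t := Finset.univ.image f ×ˢ Finset.univ.image g) (fun k => (f k, g k))
      (fun k _ => Finset.mem_coe.2 (Finset.mem_product.2
        ⟨Finset.mem_image_of_mem f (Finset.mem_univ k),
          Finset.mem_image_of_mem g (Finset.mem_univ k)⟩)) hinj.injOn
    rwa [Finset.card_univ, Fintype.card_fin] at h
  rw [Finset.card_product] at hcard
  have h1 := Nat.mul_le_mul hf hg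
  have h2 := two_mul_sq_lt_two_pow hm
  have h3 := half_two_pow_add_self (m := m) (by omega)
  nlinarith

/-! ### The union of the bases -/

theorem pairVec_apply_ne_zero_iff {m : ℕ} {e : Fin (2 ^ m) × Fin (2 ^ m)} (he : e.1 ≠ e.2)
    (σ : ZMod 2) (s : Fin (2 ^ m)) : pairVec m e σ s ≠ 0 ↔ s = e.1 ∨ s = e.2 := by
  rw [pairVec_apply]
  by_cases h1 : s = e.1
  · subst h1
    simp [he]
  · by_cases h2 : s = e.2
    · subst h2
      simp [he.symm, sgn_ne_zero]
    · simp [h1, h2]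

/-- A line determines the support of its vectors, and the endpoints cannot be swapped because they
lie in different halves. -/
theorem hmEdge_eq_of_lineProj_eq {m : ℕ} {k i l j : Fin (2 ^ m / 2)} {σ τ : ZMod 2}
    (h : lineProj (pairVec m (hmEdge m k i) σ) = lineProj (pairVec m (hmEdge m l j) τ)) :
    hmEdge m k i = hmEdge m l j := by
  obtain ⟨c, hc⟩ := exists_smul_of_lineProj_eq h
  have hs : ∀ s, (s = (hmEdge m k i).1 ∨ s = (hmEdge m k i).2) →
      (s = (hmEdge m l j).1 ∨ s = (hmEdge m l j).2) := by
    intro s hs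
    rw [← pairVec_apply_ne_zero_iff (hmEdge_ne k i) σ, hc, PiLp.smul_apply, smul_eq_mul] at hs
    exact (pairVec_apply_ne_zero_iff (hmEdge_ne l j) τ s).1 (right_ne_zero_of_mul hs)
  refine Prod.ext ((hs _ (Or.inl rfl)).resolve_right (hmEdge_fst_ne_snd _ _ _ _))
    ((hs _ (Or.inr rfl)).resolve_left (hmEdge_fst_ne_snd _ _ _ _).symm)

theorem bobBasis_disjoint {m : ℕ} {k l : Fin (2 ^ m / 2)} {P : QOp (2 ^ m)}
    (hk : P ∈ bobBasis m k) (hl : P ∈ bobBasis m l) : k = l := by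
  rw [bobBasis_eq_range] at hk hl
  obtain ⟨p, rfl⟩ := hk
  obtain ⟨q, hq⟩ := hl
  exact hmEdge_eq_matching (hmEdge_eq_of_lineProj_eq hq.symm)

/-- A sign vector has full support, a pair vector only two nonzero entries. For n = 2 the two kinds
of lines coincide, hence `2 ≤ m`. -/
theorem lineProj_signVec_ne_pairVec {m : ℕ} (hm : 2 ≤ m) (x : Fin (2 ^ m) → ZMod 2)
    {e : Fin (2 ^ m) × Fin (2 ^ m)} (he : e.1 ≠ e.2) (σ : ZMod 2) :
    lineProj (signVec m x) ≠ lineProj (pairVec m e σ) := by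
  intro h
  obtain ⟨c, hc⟩ := exists_smul_of_lineProj_eq h
  obtain ⟨s, hs⟩ : ∃ s, s ∉ ({e.1, e.2} : Finset (Fin (2 ^ m))) := by
    by_contra! h
    have h1 : (Finset.univ : Finset (Fin (2 ^ m))).card ≤ 2 :=
      (Finset.card_le_card fun s _ => h s).trans Finset.card_le_two
    rw [Finset.card_univ, Fintype.card_fin] at h1
    have := Nat.pow_le_pow_right two_pos hm
    omega
  have h0 : pairVec m e σ s = 0 := by
    by_contra h
    exact hs (by simpa using (pairVec_apply_ne_zero_iff he σ s).1 h)
  have h1 : signVec m x s = 0 := by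
    rw [hc, PiLp.smul_apply, h0, smul_zero]
  exact div_ne_zero (sgn_ne_zero _) (sqrt_two_pow_ne_zero m) h1

/-- The lines of the sign vectors. -/
theorem iUnion_aliceBasis (m : ℕ) :
    ⋃ x, aliceBasis m x = Set.range fun x => lineProj (signVec m x) := by
  ext P
  simp only [Set.mem_iUnion, aliceBasis_eq_range, Set.mem_range, aliceVec_eq]
  constructor
  · rintro ⟨x, a, rfl⟩
    exact ⟨_, rfl⟩
  · rintro ⟨x, rfl⟩
    exact ⟨x + bitChar m 0, 0, by rw [add_assoc, CharTwo.add_self_eq_zero, add_zero]⟩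

theorem aliceBasis_disjoint_bobBasis {m : ℕ} (hm : 2 ≤ m) {x : Fin (2 ^ m) → ZMod 2}
    {k : Fin (2 ^ m / 2)} {P : QOp (2 ^ m)} (hx : P ∈ aliceBasis m x) : P ∉ bobBasis m k := by
  rw [bobBasis_eq_range]
  rintro ⟨p, hp⟩
  obtain ⟨a, rfl⟩ := hx
  rw [aliceVec_eq] at hp
  exact lineProj_signVec_ne_pairVec hm _ (hmEdge_ne k p.1) p.2 hp.symm

/-- Two cosets that meet coincide: if x + χ_a and y + χ_b agree up to a constant, so do x + χ_d and
y + χ_(b⊕a⊕d). -/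
theorem aliceBasis_subset_of_mem {m : ℕ} {x y : Fin (2 ^ m) → ZMod 2} {P : QOp (2 ^ m)}
    (hx : P ∈ aliceBasis m x) (hy : P ∈ aliceBasis m y) : aliceBasis m x ⊆ aliceBasis m y := by
  obtain ⟨a, ha⟩ := hx
  obtain ⟨b, hb⟩ := hy
  rw [ha, aliceVec_eq, aliceVec_eq, lineProj_signVec_eq_iff] at hb
  obtain ⟨c, hc⟩ := hb
  rintro _ ⟨d, rfl⟩
  refine ⟨bitXor (bitXor b a) d, ?_⟩
  rw [aliceVec_eq, aliceVec_eq, lineProj_signVec_eq_iff]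
  refine ⟨c, fun s => ?_⟩
  have h := hc s
  rw [bitChar_bitXor, bitChar_bitXor]
  simp only [Pi.add_apply] at h ⊢
  have h2 := CharTwo.add_self_eq_zero (bitChar m a s)
  linear_combination h - h2

theorem aliceBasis_eq_of_mem {m : ℕ} {x y : Fin (2 ^ m) → ZMod 2} {P : QOp (2 ^ m)}
    (hx : P ∈ aliceBasis m x) (hy : P ∈ aliceBasis m y) : aliceBasis m x = aliceBasis m y :=
  (aliceBasis_subset_of_mem hx hy).antisymm (aliceBasis_subset_of_mem hy hx)

/-- Each complementary pair of strings has one member vanishing at the point 0; `φ` enumerates these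
representatives. -/
theorem ncard_iUnion_aliceBasis (m : ℕ) : (⋃ x, aliceBasis m x).ncard = 2 ^ (2 ^ m - 1) := by
  let φ : ({s : Fin (2 ^ m) // s ≠ 0} → ZMod 2) → (Fin (2 ^ m) → ZMod 2) :=
    fun z => (Equiv.funSplitAt 0 (ZMod 2)).symm (0, z)
  have hφ0 : ∀ z, φ z 0 = 0 := fun z => by simp [φ, Equiv.funSplitAt, Equiv.piSplitAt]
  have hφ : Function.Injective φ := fun z w h => by
    have := (Equiv.funSplitAt (0 : Fin (2 ^ m)) (ZMod 2)).symm.injective h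
    exact congrArg Prod.snd this
  have hinj : Function.Injective fun z => lineProj (signVec m (φ z)) := by
    intro z w h
    obtain ⟨c, hc⟩ := lineProj_signVec_eq_iff.1 h
    have hc0 : c = 0 := by
      have := hc 0
      rwa [hφ0, hφ0, zero_add, eq_comm] at this
    subst hc0
    exact hφ (funext fun s => by simpa using hc s)
  have hrange : (Set.range fun x => lineProj (signVec m x)) =
      Set.range fun z => lineProj (signVec m (φ z)) := by
    ext P
    constructor
    · rintro ⟨x, rfl⟩
      refine ⟨fun s => x s + x 0, lineProj_signVec_eq_iff.2 ⟨x 0, fun s => ?_⟩⟩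
      by_cases hs : s = 0
      · subst hs
        rw [hφ0, CharTwo.add_self_eq_zero]
      · simp [φ, Equiv.funSplitAt, Equiv.piSplitAt, hs]
    · rintro ⟨z, rfl⟩
      exact ⟨φ z, rfl⟩
  rw [iUnion_aliceBasis, hrange, ← Set.image_univ, Set.ncard_image_of_injective _ hinj,
    Set.ncard_univ, Nat.card_eq_fintype_card, Fintype.card_fun, ZMod.card]
  congr 1
  simp [Fintype.card_subtype_compl]

theorem ncard_iUnion_bobBasis {m : ℕ} (hm : 1 ≤ m) :
    (⋃ k, bobBasis m k).ncard = (2 ^ m) ^ 2 / 2 := by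
  rw [Set.ncard_iUnion_of_finite (fun k => (bobBasis_isMeasurementBasis hm k).2.2.1),
    finsum_eq_sum_of_fintype, Finset.sum_congr rfl fun k _ => (bobBasis_isMeasurementBasis hm k).2.2.2]
  · rw [Finset.sum_const, Finset.card_univ, Fintype.card_fin, smul_eq_mul, sq,
      Nat.div_mul_right_comm (dvd_pow_self 2 (by omega))]
  · intro k l hkl
    rw [Function.onFun, Set.disjoint_left]
    exact fun P hk hl => hkl (bobBasis_disjoint hk hl)

theorem finite_iUnion_aliceBasis (m : ℕ) : (⋃ x, aliceBasis m x).Finite := by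
  rw [iUnion_aliceBasis]
  exact Set.finite_range _

theorem finite_iUnion_bobBasis {m : ℕ} (hm : 1 ≤ m) : (⋃ k, bobBasis m k).Finite :=
  Set.finite_iUnion fun k => (bobBasis_isMeasurementBasis hm k).2.2.1

theorem hmSet_finite {m : ℕ} (hm : 1 ≤ m) : (hmSet m).Finite :=
  (finite_iUnion_aliceBasis m).union (finite_iUnion_bobBasis hm)

theorem ncard_hmSet {m : ℕ} (hm : 2 ≤ m) :
    (hmSet m).ncard = 2 ^ (2 ^ m - 1) + (2 ^ m) ^ 2 / 2 := by
  rw [hmSet, Set.ncard_union_eq _ (finite_iUnion_aliceBasis m)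
    (finite_iUnion_bobBasis (by omega)), ncard_iUnion_aliceBasis, ncard_iUnion_bobBasis (by omega)]
  rw [Set.disjoint_left]
  intro P hP hQ
  obtain ⟨x, hx⟩ := Set.mem_iUnion.1 hP
  obtain ⟨k, hk⟩ := Set.mem_iUnion.1 hQ
  exact aliceBasis_disjoint_bobBasis hm hx hk

theorem aliceBasis_subset_hmSet (m : ℕ) (x : Fin (2 ^ m) → ZMod 2) : aliceBasis m x ⊆ hmSet m :=
  (Set.subset_iUnion (aliceBasis m) x).trans Set.subset_union_left

theorem bobBasis_subset_hmSet (m : ℕ) (k : Fin (2 ^ m / 2)) : bobBasis m k ⊆ hmSet m :=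
  (Set.subset_iUnion (bobBasis m) k).trans Set.subset_union_right

theorem hmSet_isRankOneProjector {m : ℕ} (hm : 1 ≤ m) {P : QOp (2 ^ m)} (hP : P ∈ hmSet m) :
    IsRankOneProjector P := by
  rcases hP with hP | hP
  · obtain ⟨x, hx⟩ := Set.mem_iUnion.1 hP
    exact (aliceBasis_isMeasurementBasis m x).1 P hx
  · obtain ⟨k, hk⟩ := Set.mem_iUnion.1 hP
    exact (bobBasis_isMeasurementBasis hm k).1 P hk

/-- A coloring selects one projector of every measurement basis contained in the set. -/
theorem IsZeroOneColoring.exists_eq_one {n : ℕ} {S B : Set (QOp n)} {f : QOp n → ℕ}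
    (hf : IsZeroOneColoring S f) (hBS : B ⊆ S) (hB : IsMeasurementBasis B) :
    ∃ P ∈ B, f P = 1 := by
  have h := hf.2.2 hB.2.2.1.toFinset (by simpa using hBS) (by simpa using hB)
  by_contra! hne
  rw [Finset.sum_eq_zero] at h
  · exact zero_ne_one h
  · intro P hP
    have hPB : P ∈ B := by simpa using hP
    exact (hf.1 P (hBS hPB)).resolve_right (hne P hPB)

/-- The selected projectors of a coloring are not orthogonal. -/
theorem IsZeroOneColoring.mul_ne_zero {n : ℕ} {S : Set (QOp n)} {f : QOp n → ℕ}
    (hf : IsZeroOneColoring S f) {P Q : QOp n} (hP : P ∈ S) (hQ : Q ∈ S) (hfP : f P = 1)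
    (hfQ : f Q = 1) (hPQ : P ≠ Q) (hstarP : IsStarProjection P) (hstarQ : IsStarProjection Q) :
    P * Q ≠ 0 := by
  classical
  intro h
  have h1 := hf.2.1 {P, Q} (by
    intro R hR
    rcases (by simpa using hR : R = P ∨ R = Q) with rfl | rfl
    · exact hP
    · exact hQ) (by
    rw [MutuallyOrthogonal, Finset.coe_pair, Set.pairwise_pair]
    exact fun _ => ⟨h, hstarP.mul_eq_zero_symm hstarQ h⟩)
  rw [Finset.sum_pair hPQ, hfP, hfQ] at h1
  omega

/-- The projectors selected by a coloring in P_x and Q_M would be the players' answers; a losing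
pair would be two distinct orthogonal projectors of value 1. -/
theorem hmSet_isKochenSpeckerSet {m : ℕ} (hm : 17 ≤ m) : IsKochenSpeckerSet (hmSet m) := by
  refine ⟨hmSet_finite (by omega), fun P hP => hmSet_isRankOneProjector (by omega) hP, ?_⟩
  rintro ⟨f, hf⟩
  have hA : ∀ x, ∃ a, f (lineProj (aliceVec m x a)) = 1 := by
    intro x
    obtain ⟨P, ⟨a, rfl⟩, h⟩ := hf.exists_eq_one (aliceBasis_subset_hmSet m x)
      (aliceBasis_isMeasurementBasis m x)
    exact ⟨a, h⟩
  have hB : ∀ k, ∃ p : (Fin (2 ^ m) × Fin (2 ^ m)) × Fin (2 ^ m),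
      p.1 ∈ hmMatching m k ∧ f (lineProj (bobVec m p.1 p.2)) = 1 := by
    intro k
    obtain ⟨P, ⟨e, he, b, rfl⟩, h⟩ := hf.exists_eq_one (bobBasis_subset_hmSet m k)
      (bobBasis_isMeasurementBasis (by omega) k)
    exact ⟨(e, b), he, h⟩
  choose A hA using hA
  choose B hBM hB using hB
  refine no_classical_strategy hm ⟨A, B, fun x k => ?_⟩
  by_contra hlose
  have hPA : lineProj (aliceVec m x (A x)) ∈ aliceBasis m x := ⟨_, rfl⟩
  have hQB : lineProj (bobVec m (B k).1 (B k).2) ∈ bobBasis m k := ⟨_, hBM k, _, rfl⟩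
  refine hf.mul_ne_zero (aliceBasis_subset_hmSet m x hPA) (bobBasis_subset_hmSet m k hQB) (hA x)
    (hB k) (fun h => aliceBasis_disjoint_bobBasis (by omega) hPA (h ▸ hQB))
    isStarProjection_starProjection isStarProjection_starProjection ?_
  exact lineProj_mul_eq_zero (inner_aliceVec_bobVec_of_losing (hBM k) hlose)

theorem lovaszTheta_hmGraph {m : ℕ} (hm : 2 ≤ m) :
    lovaszTheta (hmGraph m) = (2 : ℝ) ^ (2 ^ m - 1) / 2 ^ m + 2 ^ m / 2 := by
  classical
  have h := lovaszTheta_of_partition (S := hmSet m)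
    -- Different inputs x may give the same basis; the image merges these repetitions, and distinct
    -- bases are disjoint.
    (Finset.univ.image (aliceBasis m) ∪ Finset.univ.image (bobBasis m)) (by positivity)
    ⟨_, aliceBasis_subset_hmSet m 0 ⟨0, rfl⟩⟩ ?_ ?_ ?_
  · rw [hmGraph, h, ncard_hmSet hm]
    have h2 : (2 ^ m) ^ 2 / 2 = 2 ^ m / 2 * 2 ^ m := by
      rw [sq, Nat.div_mul_right_comm (dvd_pow_self 2 (by omega))]
    have hh := congrArg (Nat.cast (R := ℝ)) (half_two_pow_add_self (m := m) (by omega))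
    rw [h2]
    push_cast at hh ⊢
    have hh' : ((2 ^ m / 2 : ℕ) : ℝ) = 2 ^ m / 2 := by linarith
    rw [hh']
    field_simp
  · intro B hB
    simp only [Finset.mem_union, Finset.mem_image, Finset.mem_univ, true_and] at hB
    rcases hB with ⟨x, rfl⟩ | ⟨k, rfl⟩
    · exact aliceBasis_isMeasurementBasis m x
    · exact bobBasis_isMeasurementBasis (by omega) k
  · ext P
    simp only [hmSet, Set.mem_union, Set.mem_iUnion, Finset.mem_union, Finset.mem_image,
      Finset.mem_univ, true_and, exists_prop]
    constructor
    · rintro (⟨x, hx⟩ | ⟨k, hk⟩)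
      · exact ⟨_, Or.inl ⟨x, rfl⟩, hx⟩
      · exact ⟨_, Or.inr ⟨k, rfl⟩, hk⟩
    · rintro ⟨_, ⟨x, rfl⟩ | ⟨k, rfl⟩, hP⟩
      · exact Or.inl ⟨x, hP⟩
      · exact Or.inr ⟨k, hP⟩
  · intro B hB B' hB' P hP hP'
    simp only [Finset.mem_union, Finset.mem_image, Finset.mem_univ, true_and] at hB hB'
    rcases hB with ⟨x, rfl⟩ | ⟨k, rfl⟩ <;> rcases hB' with ⟨y, rfl⟩ | ⟨l, rfl⟩
    · exact aliceBasis_eq_of_mem hP hP'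
    · exact absurd hP' (aliceBasis_disjoint_bobBasis hm hP)
    · exact absurd hP (aliceBasis_disjoint_bobBasis hm hP')
    · rw [bobBasis_disjoint hP hP']

/-! ### The independence number -/

/-- Strings with equal coordinate sum are at even distance, so two parity classes suffice to meet
the evenness hypothesis of the code bound. -/
theorem natCast_hammingDist {ι : Type*} [Fintype ι] (x y : ι → ZMod 2) :
    (hammingDist x y : ZMod 2) = ∑ i, x i + ∑ i, y i := by
  rw [hammingDist, Finset.card_filter, ← Finset.sum_add_distrib]
  push_cast
  refine Finset.sum_congr rfl fun i _ => ?_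
  generalize x i = a
  generalize y i = b
  revert a b
  decide

theorem sum_sgn_add {ι : Type*} [Fintype ι] (x y : ι → ZMod 2) :
    ∑ i, sgn (x i + y i) = Fintype.card ι - 2 * hammingDist x y := by
  rw [hammingDist, Finset.card_filter, ← Finset.card_univ, Finset.card_eq_sum_ones]
  push_cast
  rw [Finset.mul_sum, ← Finset.sum_sub_distrib]
  refine Finset.sum_congr rfl fun i _ => ?_
  by_cases h : x i = y i
  · simp [h, CharTwo.add_self_eq_zero, sgn_zero]
  · have h1 : x i + y i = 1 := by
      rcases zmod_two_cases (x i) with h1 | h1 <;> rcases zmod_two_cases (y i) with h2 | h2 <;>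
        simp_all
    rw [h1, sgn_one, if_pos h]
    norm_num

/-- A set of pairwise non-orthogonal projectors on lines of sign vectors is small. -/
theorem card_le_of_nonorthogonal_signVec {m k : ℕ} (hm : 2 ≤ m) (hk : k + 1 = 2 ^ (m - 2))
    (J : Finset (QOp (2 ^ m))) (hJ : ∀ P ∈ J, ∃ x, P = lineProj (signVec m x))
    (hort : ∀ P ∈ J, ∀ Q ∈ J, P ≠ Q → P * Q ≠ 0) :
    J.card ≤ 2 * (Finset.univ.filter fun T : Finset (Fin (2 ^ m)) => T.card ≤ k).card := by
  classical
  choose! ρ hρ using hJ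
  have hpar : ∀ c : ZMod 2, (J.filter fun P => ∑ i, ρ P i = c).card ≤
      (Finset.univ.filter fun T : Finset (Fin (2 ^ m)) => T.card ≤ k).card := by
    intro c
    have hinj : Set.InjOn ρ (J.filter fun P => ∑ i, ρ P i = c) := by
      intro P hP Q hQ h
      rw [hρ P (Finset.mem_filter.1 hP).1, hρ Q (Finset.mem_filter.1 hQ).1, h]
    rw [← Finset.card_image_of_injOn hinj]
    refine card_le_of_forbidden_distances hk _ ?_ ?_
    · intro x hx y hy
      obtain ⟨P, hP, rfl⟩ := Finset.mem_image.1 hx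
      obtain ⟨Q, hQ, rfl⟩ := Finset.mem_image.1 hy
      rw [← ZMod.natCast_eq_zero_iff, natCast_hammingDist, (Finset.mem_filter.1 hP).2,
        (Finset.mem_filter.1 hQ).2, CharTwo.add_self_eq_zero]
    · intro x hx y hy hxy hdvd
      obtain ⟨P, hP, rfl⟩ := Finset.mem_image.1 hx
      obtain ⟨Q, hQ, rfl⟩ := Finset.mem_image.1 hy
      have hPJ := (Finset.mem_filter.1 hP).1
      have hQJ := (Finset.mem_filter.1 hQ).1
      have hPQ : P ≠ Q := fun h => hxy (by rw [h])
      have hle : hammingDist (ρ P) (ρ Q) ≤ 2 ^ m := by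
        simpa using hammingDist_le_card_fintype (x := ρ P) (y := ρ Q)
      have hpos : 0 < hammingDist (ρ P) (ρ Q) := hammingDist_pos.2 hxy
      have hpow : 2 ^ m = 2 * 2 ^ (m - 2 + 1) := by
        rw [← pow_succ']
        congr 1
        omega
      obtain ⟨t, ht⟩ := hdvd
      have hp : 0 < 2 ^ (m - 2 + 1) := by positivity
      have ht2 : t ≤ 2 := by
        by_contra h
        have := Nat.mul_le_mul_left (2 ^ (m - 2 + 1)) (Nat.succ_le_of_lt (not_le.1 h))
        omega
      -- The distance is t · n/2: t = 0 contradicts distinctness, t = 1 is orthogonality, and t = 2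
      -- means complementary strings, hence the same line.
      interval_cases t
      · omega
      · refine hort P hPJ Q hQJ hPQ ?_
        rw [hρ P hPJ, hρ Q hQJ]
        apply lineProj_mul_eq_zero
        rw [inner_signVec, sum_sgn_add, ht, Fintype.card_fin, mul_one, hpow]
        push_cast
        rw [sub_self, zero_div]
      · apply hPQ
        rw [hρ P hPJ, hρ Q hQJ, lineProj_signVec_eq_iff]
        refine ⟨1, fun s => ?_⟩
        have hall : (Finset.univ.filter fun i => ρ P i ≠ ρ Q i) = Finset.univ := by
          rw [← Finset.card_eq_iff_eq_univ, Fintype.card_fin]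
          exact ht.trans ((mul_comm _ _).trans hpow.symm)
        have hs : ρ P s ≠ ρ Q s := by
          have h := Finset.mem_univ s
          rw [← hall] at h
          exact (Finset.mem_filter.1 h).2
        have hne : ∀ z w : ZMod 2, z ≠ w → z = w + 1 := by decide
        exact hne _ _ hs
  have hsplit : J = (J.filter fun P => ∑ i, ρ P i = 0) ∪ J.filter fun P => ∑ i, ρ P i = 1 := by
    rw [← Finset.filter_or, Finset.filter_true_of_mem fun P _ => zmod_two_cases _]
  calc J.card ≤ (J.filter fun P => ∑ i, ρ P i = 0).card
        + (J.filter fun P => ∑ i, ρ P i = 1).card := by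
        conv_lhs => rw [hsplit]
        exact Finset.card_union_le _ _
    _ ≤ _ := by
        rw [two_mul]
        exact add_le_add (hpar 0) (hpar 1)

theorem indepNum_hmGraph_le {m k : ℕ} (hm : 2 ≤ m) (hk : k + 1 = 2 ^ (m - 2)) :
    (hmGraph m).indepNum ≤
      2 * (Finset.univ.filter fun T : Finset (Fin (2 ^ m)) => T.card ≤ k).card
        + (2 ^ m) ^ 2 / 2 := by
  classical
  have : Fintype (hmSet m) := (hmSet_finite (by omega)).fintype
  obtain ⟨I, hI⟩ := (hmGraph m).exists_isNIndepSet_indepNum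
  rw [← hI.2]
  let J := I.map (Function.Embedding.subtype _)
  have hJ : ∀ P ∈ J, ∃ h : P ∈ hmSet m, (⟨P, h⟩ : hmSet m) ∈ I := by
    intro P hP
    obtain ⟨P', hP', rfl⟩ := Finset.mem_map.1 hP
    exact ⟨P'.2, hP'⟩
  have hort : ∀ P ∈ J, ∀ Q ∈ J, P ≠ Q → P * Q ≠ 0 := by
    intro P hP Q hQ hPQ h
    obtain ⟨hPS, hPI⟩ := hJ P hP
    obtain ⟨hQS, hQI⟩ := hJ Q hQ
    have hne : (⟨P, hPS⟩ : hmSet m) ≠ ⟨Q, hQS⟩ := fun h' => hPQ (congrArg Subtype.val h')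
    exact hI.1 hPI hQI hne ((SimpleGraph.fromRel_adj _ _ _).2 ⟨hne, Or.inl h⟩)
  rw [← Finset.card_map (Function.Embedding.subtype _),
    ← Finset.card_filter_add_card_filter_not (s := J) fun P => P ∈ ⋃ x, aliceBasis m x]
  refine add_le_add ?_ ?_
  · refine card_le_of_nonorthogonal_signVec hm hk _ ?_ ?_
    · intro P hP
      have h := (Finset.mem_filter.1 hP).2
      rw [iUnion_aliceBasis] at h
      obtain ⟨x, hx⟩ := h
      exact ⟨x, hx.symm⟩
    · exact fun P hP Q hQ =>
        hort P (Finset.mem_filter.1 hP).1 Q (Finset.mem_filter.1 hQ).1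
  · rw [← ncard_iUnion_bobBasis (m := m) (by omega), ← Set.ncard_coe_finset]
    refine Set.ncard_le_ncard ?_ (finite_iUnion_bobBasis (by omega))
    intro P hP
    obtain ⟨h1, h2⟩ := Finset.mem_filter.1 (Finset.mem_coe.1 hP)
    exact (hJ P h1).1.resolve_left h2

/-! ### Numerical comparison of α with θ -/

theorem mul_le_three_halves_pow {q : ℕ} (hq : 32 ≤ q) : (64 * q : ℝ) ≤ (3 / 2) ^ q := by
  induction q, hq using Nat.le_induction with
  | base => norm_num
  | succ q hq ih =>
    have hq' : (32 : ℝ) ≤ q := by exact_mod_cast hq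
    rw [pow_succ]
    push_cast
    linarith

/-- Here q = n/4. The code term is (2 · (3/2)^4)^q = (81/8)^q, and (81/8) · (3/2) < 16 leaves a
factor (3/2)^q ≥ 64q to spare. The quadratic term is at most (81/8)^q as well. -/
theorem indepNum_bound_numeric {q : ℕ} (hq : 32 ≤ q) :
    2 * (2 ^ (q - 1) * (3 / 2 : ℝ) ^ (4 * q)) + (4 * q) ^ 2 / 2 ≤
      1 / 4 * ((2 : ℝ) ^ (4 * q - 1) / (4 * q)) := by
  have h64 := mul_le_three_halves_pow hq
  have hq0 : (0 : ℝ) < q := by exact_mod_cast (by omega : 0 < q)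
  have h1 : 2 * (2 ^ (q - 1) * (3 / 2 : ℝ) ^ (4 * q)) = (81 / 8) ^ q := by
    rw [← mul_assoc, ← pow_succ', Nat.sub_add_cancel (by omega), pow_mul, ← mul_pow]
    norm_num
  have h2 : (2 : ℝ) ^ (4 * q - 1) = 16 ^ q / 2 := by
    have h : (2 : ℝ) * 2 ^ (4 * q - 1) = 16 ^ q := by
      rw [← pow_succ', Nat.sub_add_cancel (by omega), pow_mul]
      norm_num
    linarith
  have h3 : (81 / 8 : ℝ) ^ q * (3 / 2) ^ q ≤ 16 ^ q := by
    rw [← mul_pow]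
    exact pow_le_pow_left₀ (by norm_num) (by norm_num) q
  have h4 : ((3 / 2 : ℝ) ^ q) ^ 2 ≤ (81 / 8) ^ q := by
    rw [← pow_mul, mul_comm, pow_mul]
    exact pow_le_pow_left₀ (by norm_num) (by norm_num) q
  have h5 : (64 * q : ℝ) ^ 2 ≤ ((3 / 2 : ℝ) ^ q) ^ 2 := pow_le_pow_left₀ (by positivity) h64 2
  have h6 : (81 / 8 : ℝ) ^ q * (64 * q) ≤ 16 ^ q :=
    (mul_le_mul_of_nonneg_left h64 (by positivity)).trans h3
  have h7 : (4 * q : ℝ) ^ 2 / 2 ≤ (81 / 8) ^ q := by nlinarith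
  rw [h1, h2]
  have h8 : 1 / 4 * ((16 : ℝ) ^ q / 2 / (4 * q)) = 16 ^ q / (32 * q) := by
    field_simp
    norm_num
  rw [h8, le_div_iff₀ (by positivity)]
  nlinarith

theorem indepNum_hmGraph_le_theta {m : ℕ} (hm : 7 ≤ m) :
    ((hmGraph m).indepNum : ℝ) ≤ 1 / 4 * lovaszTheta (hmGraph m) := by
  have hq : 2 ^ 5 ≤ 2 ^ (m - 2) := Nat.pow_le_pow_right two_pos (by omega)
  have hpow : 2 ^ m = 4 * 2 ^ (m - 2) := by
    rw [show (4 : ℕ) = 2 ^ 2 by norm_num, ← pow_add]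
    congr 1
    omega
  have hpowR : (2 : ℝ) ^ m = 4 * ((2 ^ (m - 2) : ℕ) : ℝ) := by exact_mod_cast hpow
  have hα : ((hmGraph m).indepNum : ℝ) ≤
      2 * ((Finset.univ.filter fun T : Finset (Fin (2 ^ m)) => T.card ≤ 2 ^ (m - 2) - 1).card : ℝ)
        + (2 ^ m) ^ 2 / 2 := by
    have h := indepNum_hmGraph_le (m := m) (k := 2 ^ (m - 2) - 1) (by omega) (by omega)
    have h2 : (((2 ^ m) ^ 2 / 2 : ℕ) : ℝ) ≤ (2 ^ m) ^ 2 / 2 := by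
      refine Nat.cast_div_le.trans ?_
      push_cast
      exact le_rfl
    refine (Nat.cast_le.2 h).trans ?_
    push_cast at h2 ⊢
    linarith
  have hT := card_filter_card_le_bound (ι := Fin (2 ^ m)) (2 ^ (m - 2) - 1)
  rw [Fintype.card_fin] at hT
  have hnum := indepNum_bound_numeric (q := 2 ^ (m - 2)) hq
  rw [lovaszTheta_hmGraph (by omega)]
  rw [← hpow, ← hpowR] at hnum
  have hpos : (0 : ℝ) < 2 ^ m := by positivity
  linarith

/-! ### The theorem and the biases -/

theorem mainTheorem1 :
    (∀ m : ℕ, 17 ≤ m →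
      -- the game is a pseudo-telepathy game: no classical strategy wins with certainty ...
      (¬ ∃ (A : (Fin (2 ^ m) → ZMod 2) → Fin (2 ^ m))
          (B : Fin (2 ^ m / 2) → (Fin (2 ^ m) × Fin (2 ^ m)) × Fin (2 ^ m)),
          ∀ x k, HMWins m x k (A x) (B k).1 (B k).2) ∧
      -- ... while the quantum strategy consists of measurements and wins with certainty
      (∀ x, ∑ a, InnerProductSpace.rankOne ℂ (aliceVec m x a) (aliceVec m x a) = 1) ∧
      (∀ k, ∑ e ∈ hmMatching m k, ∑ b,
        InnerProductSpace.rankOne ℂ (bobVec m e b) (bobVec m e b) = 1) ∧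
      (∀ x k, hmQuantumWinProb m x k = 1) ∧
      (∀ x, IsMeasurementBasis (aliceBasis m x)) ∧
      (∀ k, IsMeasurementBasis (bobBasis m k)) ∧
      -- the union of the bases is a Kochen-Specker set with the stated number of projectors
      IsKochenSpeckerSet (hmSet m) ∧
      (hmSet m).ncard = 2 ^ (2 ^ m - 1) + (2 ^ m) ^ 2 / 2 ∧
      -- the quantum and the classical value
      lovaszTheta (hmGraph m) = (2 : ℝ) ^ (2 ^ m - 1) / 2 ^ m + 2 ^ m / 2 ∧
      ((hmGraph m).indepNum : ℝ) ≤
        (1 / 2 + 8 * Real.sqrt (2 ^ m) * Real.logb 2 (2 ^ m) / (2 ^ m - 1)) *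
          lovaszTheta (hmGraph m) ∧
      -- the quantum and the classical bias
      quantumBias (hmGraph m) = 1 / 2 ∧
      classicalBias (hmGraph m) ≤ 8 * Real.sqrt (2 ^ m) * Real.logb 2 (2 ^ m) / (2 ^ m - 1) ∧
      ((2 : ℝ) ^ m - 1) / (16 * Real.sqrt (2 ^ m) * Real.logb 2 (2 ^ m)) *
        classicalBias (hmGraph m) ≤ quantumBias (hmGraph m)) ∧
    -- the ratio of the biases is `O(√n / log n)`
    (∃ C : ℝ, 0 < C ∧ ∀ m : ℕ, 17 ≤ m →
      classicalBias (hmGraph m) ≠ 0 ∧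
      |quantumBias (hmGraph m) / classicalBias (hmGraph m)| ≤
        C * (Real.sqrt (2 ^ m) / Real.logb 2 (2 ^ m))) := by
  have hlog : ∀ m : ℕ, Real.logb 2 (2 ^ m) = m := fun m => by
    rw [Real.logb_pow, Real.logb_self_eq_one one_lt_two, mul_one]
  have hθ : ∀ m : ℕ, 17 ≤ m → 0 < lovaszTheta (hmGraph m) := by
    intro m hm
    rw [lovaszTheta_hmGraph (by omega)]
    positivity
  have hq : ∀ m : ℕ, 17 ≤ m → quantumBias (hmGraph m) = 1 / 2 := by
    intro m hm
    rw [quantumBias, div_self (hθ m hm).ne']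
    norm_num
  -- The bias is bounded away from zero on the negative side, which settles both its upper bounds
  -- and the size of the ratio.
  have hc : ∀ m : ℕ, 17 ≤ m → classicalBias (hmGraph m) ≤ -(1 / 4) := by
    intro m hm
    have h := (div_le_iff₀ (hθ m hm)).2 (indepNum_hmGraph_le_theta (m := m) (by omega))
    rw [classicalBias]
    linarith
  -- The constant is (1/2) / (1/4) = 2, since √n / log n ≥ 1.
  refine ⟨fun m hm => ?_, 2, two_pos, fun m hm => ⟨?_, ?_⟩⟩
  · have hn : (0 : ℝ) ≤ 2 ^ m - 1 := sub_nonneg.2 (one_le_pow₀ one_le_two)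
    have hε : (0 : ℝ) ≤ 8 * Real.sqrt (2 ^ m) * Real.logb 2 (2 ^ m) / (2 ^ m - 1) := by
      rw [hlog]
      positivity
    refine ⟨no_classical_strategy hm, sum_rankOne_aliceVec m, sum_rankOne_bobVec (by omega),
      hmQuantumWinProb_eq_one (by omega), aliceBasis_isMeasurementBasis m,
      bobBasis_isMeasurementBasis (by omega), hmSet_isKochenSpeckerSet hm, ncard_hmSet (by omega),
      lovaszTheta_hmGraph (by omega), ?_, hq m hm, ?_, ?_⟩
    · refine (indepNum_hmGraph_le_theta (by omega)).trans ?_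
      exact mul_le_mul_of_nonneg_right (by linarith) (hθ m hm).le
    · linarith [hc m hm]
    · rw [hq m hm]
      have h1 : (0 : ℝ) ≤ (2 ^ m - 1) / (16 * Real.sqrt (2 ^ m) * Real.logb 2 (2 ^ m)) := by
        rw [hlog]
        positivity
      have h2 : classicalBias (hmGraph m) ≤ 0 := by linarith [hc m hm]
      linarith [mul_nonpos_of_nonneg_of_nonpos h1 h2]
  · linarith [hc m hm]
  · have hcm := hc m hm
    have hle : (m : ℝ) ≤ Real.sqrt (2 ^ m) := by
      apply Real.le_sqrt_of_sq_le
      have h := two_mul_sq_lt_two_pow hm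
      exact_mod_cast (by omega : m ^ 2 ≤ 2 ^ m)
    have hm0 : (0 : ℝ) < m := by exact_mod_cast (by omega : 0 < m)
    have h1 : 1 ≤ Real.sqrt (2 ^ m) / m := (one_le_div hm0).2 hle
    rw [hlog, hq m hm, abs_div, abs_of_neg (by linarith : classicalBias (hmGraph m) < 0),
      abs_of_pos (by norm_num : (0 : ℝ) < 1 / 2), div_le_iff₀ (by linarith)]
    nlinarith
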